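/- Work in the plane $\mathbb C$. For $w\in\mathbb C\setminus\{0\}$ let $\arg w\in[0,2\pi)$. An arc is a homeomorphic image $\Lambda$ of $[0,1]$; for $x,y\in\Lambda$ let $\Lambda(x,y)$ be the subarc of $\Lambda$ between $x$ and $y$. For $t\ge 1$, an arc $\Lambda$ is a *$t$-quasi-arc* if there is $c>0$ with $(\operatorname{diam}\Lambda(x,y))^t\le c\,|x-y|$ for all $x,y\in\Lambda$. Let $z_0,\dots,z_\ell\in\mathbb C$ be the distinct successive vertices of a polygonal line and let $0<q<\ell$ satisfy $\operatorname{Im}\frac{z_q-z_0}{z_\ell-z_0}>0$. Let $\Pi_0$ be the interior of the triangle $z_0z_\ell z_q$, let $\Pi_1$ be its closure, and for $1\le j\le\ell$ let $S_j$ be the orientation preserving similitude with $S_j(z_0)=z_{j-1}$ and $S_j(z_\ell)=z_j$. The polygonal line is a *basic figure* if: $z_1,z_{\ell-1}\in\overline{z_0z_\ell}$ and $z_{\ell-1}\in\overline{z_1z_\ell}$; every $z_j$ lies in $\{z_q\}\cup\overline{z_0z_\ell}\cup\Pi_0$; every $S_j$ is contractive; the sets $S_j(\Pi_0)$ are pairwise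 disjoint; $S_j(z_q)\in\Pi_1$ for all $j$; and $S_j(\Pi_1)\cap(\overline{z_qz_0}\cup\overline{z_qz_\ell})=\emptyset$ for $j\notin\{1,\ell,q,q+1\}$. Its corner angles are $$\theta_p=\arg\frac{S_p(z_q)-z_p}{S_{p+1}(z_q)-z_p}\quad(1\le p\le\ell-1),\qquad \theta_{\min}=\min_p\theta_p,$$ and its characteristic angle is $\theta_{\min}+\min(\eta_1,\eta_2)$, where $$\eta_1=\arg\frac{S_q(z_q)-z_q}{z_0-z_q},\qquad \eta_2=\arg\frac{z_\ell-z_q}{S_{q+1}(z_q)-z_q}.$$ A *regular self-similar arc* is the non-empty compact set $\Lambda=\bigcup_{j=1}^{\ell}S_j(\Lambda)$ of a basic figure with positive characteristic angle, provided that $\Lambda$ is an arc, that $S_j(\Lambda)\cap S_{j+1}(\Lambda)$ is a single point for $1\le j<\ell$, and that $S_i(\Lambda)\cap S_j(\Lambda)=\emptyset$ for $|i-j|>1$. **Theorem.** (1) There is a regular self-similar arc with $\theta_{\min}=0$ that is a $t$-quasi-arc for no $t\ge 1$. (2) For each $t_0>1$ there is a regular self-similar arc with $\theta_{\min}=0$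 that is a $t_0$-quasi-arc but is a $t$-quasi-arc for no $t\in[1,t_0)$. (3) For each $t_0\ge 1$ there is a regular self-similar arc with $\theta_{\min}=0$ that is a $t$-quasi-arc for every $t>t_0$ but is not a $t_0$-quasi-arc. -/

import Mathlib

noncomputable section

namespace RegularArc

/-- `h` parametrizes the arc `Λ`: it is a homeomorphism of `[0,1]` onto `Λ` (a continuous
injection of the compact interval into a metric space is a homeomorphism onto its range). -/
structure IsArcParam {E : Type*} [MetricSpace E] (Λ : Set E) (h : unitInterval → E) : Prop where
  continuous : Continuous h
  injective : Function.Injective h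
  range_eq : Set.range h = Λ

/-- An arc: a homeomorphic image of `[0,1]`. -/
def IsArc {E : Type*} [MetricSpace E] (Λ : Set E) : Prop :=
  ∃ h : unitInterval → E, IsArcParam Λ h

/-- `Λ` is a `t`-quasi-arc: `Λ` is an arc and there is `c > 0` with
`(diam Λ(x,y)) ^ t ≤ c * |x - y|` for all `x, y ∈ Λ`. For `x = h a` and `y = h b` the subarc
`Λ(x,y)` is the image of the interval between `a` and `b`; it does not depend on `h`. -/
def IsQuasiArc {E : Type*} [MetricSpace E] (t : ℝ) (Λ : Set E) : Prop :=
  ∃ h : unitInterval → E, IsArcParam Λ h ∧ ∃ c : ℝ, 0 < c ∧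
    ∀ a b : unitInterval, Metric.diam (h '' Set.uIcc a b) ^ t ≤ c * dist (h a) (h b)

/-- `Λ` is the (non-empty compact) self-similar set of the maps `S 1, …, S ℓ`. -/
structure IsSelfSimilarSet {E : Type*} [MetricSpace E] (ℓ : ℕ) (S : ℕ → E → E) (Λ : Set E) :
    Prop where
  isCompact : IsCompact Λ
  nonempty : Λ.Nonempty
  eq_iUnion : Λ = ⋃ j ∈ Set.Icc 1 ℓ, S j '' Λ

/-- `Λ` is a self-similar arc for the maps `S 1, …, S ℓ`. -/
structure IsSelfSimilarArc {E : Type*} [MetricSpace E] (ℓ : ℕ) (S : ℕ → E → E) (Λ : Set E) :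
    Prop extends IsSelfSimilarSet ℓ S Λ where
  isArc : IsArc Λ
  inter_succ : ∀ j, 1 ≤ j → j + 1 ≤ ℓ → ∃ z, S j '' Λ ∩ S (j + 1) '' Λ = {z}
  disjoint : ∀ i j, 1 ≤ i → i + 1 < j → j ≤ ℓ → Disjoint (S i '' Λ) (S j '' Λ)

/-- The argument of a complex number, normalized to lie in `[0, 2π)`. -/
def argPos (w : ℂ) : ℝ := toIcoMod Real.two_pi_pos 0 (Complex.arg w)

/-- A polygonal line in the plane with vertices `A 0, …, A ℓ` and a marked vertex `A q`
(the values `A j` for `j > ℓ` are never used). -/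
structure Polygon where
  ℓ : ℕ
  A : ℕ → ℂ
  q : ℕ

namespace Polygon

variable (P : Polygon)

/-- For `1 ≤ j ≤ ℓ`, the orientation preserving similitude with `A 0 ↦ A (j-1)`, `A ℓ ↦ A j`. -/
def S (j : ℕ) (z : ℂ) : ℂ :=
  P.A (j - 1) + (P.A j - P.A (j - 1)) / (P.A P.ℓ - P.A 0) * (z - P.A 0)

/-- The interior of the triangle with corners `A 0`, `A ℓ`, `A q`. -/
def openTriangle : Set ℂ := interior (convexHull ℝ {P.A 0, P.A P.ℓ, P.A P.q})

/-- The basic triangle: the closure of the open triangle. -/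
def triangle : Set ℂ := closure P.openTriangle

/-- The polygon is a basic figure, with the marked vertex to the left of the oriented base. -/
structure IsBasicFigure : Prop where
  q_pos : 0 < P.q
  q_lt : P.q < P.ℓ
  vertices_injOn : Set.InjOn P.A (Set.Iic P.ℓ)
  first_mem : P.A 1 ∈ segment ℝ (P.A 0) (P.A P.ℓ)
  last_mem : P.A (P.ℓ - 1) ∈ segment ℝ (P.A 0) (P.A P.ℓ)
  last_mem' : P.A (P.ℓ - 1) ∈ segment ℝ (P.A 1) (P.A P.ℓ)
  vertices_mem : ∀ j ≤ P.ℓ, P.A j ∈ {P.A P.q} ∪ segment ℝ (P.A 0) (P.A P.ℓ) ∪ P.openTriangle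
  contractive : ∀ j, 1 ≤ j → j ≤ P.ℓ → ‖(P.A j - P.A (j - 1)) / (P.A P.ℓ - P.A 0)‖ < 1
  disjoint : ∀ i j, 1 ≤ i → i < j → j ≤ P.ℓ →
    Disjoint (P.S i '' P.openTriangle) (P.S j '' P.openTriangle)
  apex_mem : ∀ j, 1 ≤ j → j ≤ P.ℓ → P.S j (P.A P.q) ∈ P.triangle
  sides : ∀ j, 1 ≤ j → j ≤ P.ℓ → j ≠ 1 → j ≠ P.ℓ → j ≠ P.q → j ≠ P.q + 1 →
    P.S j '' P.triangle ∩
      (segment ℝ (P.A P.q) (P.A 0) ∪ segment ℝ (P.A P.q) (P.A P.ℓ)) = ∅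
  orientation : 0 < ((P.A P.q - P.A 0) / (P.A P.ℓ - P.A 0)).im

/-- The corner angle at the vertex `A p`, for `1 ≤ p ≤ ℓ - 1`. -/
def theta (p : ℕ) : ℝ :=
  argPos ((P.S p (P.A P.q) - P.A p) / (P.S (p + 1) (P.A P.q) - P.A p))

/-- The minimal corner angle (the infimum of a finite set, non-empty as soon as `2 ≤ ℓ`). -/
def thetaMin : ℝ := sInf (P.theta '' Set.Icc 1 (P.ℓ - 1))

def eta₁ : ℝ := argPos ((P.S P.q (P.A P.q) - P.A P.q) / (P.A 0 - P.A P.q))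

def eta₂ : ℝ := argPos ((P.A P.ℓ - P.A P.q) / (P.S (P.q + 1) (P.A P.q) - P.A P.q))

/-- The characteristic angle. -/
def characteristicAngle : ℝ := P.thetaMin + min P.eta₁ P.eta₂

/-- `Λ` is the regular self-similar arc generated by `P`: `P` is a basic figure with positive
characteristic angle, and its self-similar set `Λ` is an arc. -/
structure GeneratesRegularArc (Λ : Set ℂ) : Prop where
  isBasicFigure : P.IsBasicFigure
  characteristicAngle_pos : 0 < P.characteristicAngle
  isSelfSimilarArc : IsSelfSimilarArc P.ℓ P.S Λ

end Polygon

end RegularArc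

end

/-!
The curves come from a family of five-piece polygons with base `[0, 1]` in which the first piece has
ratio `4 / 9`, the last piece has ratio `r`, and the first two pieces share a side of their
triangles. Seen from the corner between them, the first piece consists of copies of one figure
scaled by `r ^ m`, the second of copies of another one scaled by `(2 / 3) ^ (2 * n + 5)`. The two
figures lie on different sides of the common side and touch it only at the images of the apex, so
the distance between the copies with indices `m` and `n` is at least a multiple of
`|r ^ m - (2 / 3) ^ (2 * n + 5)|`, and the apices realize it. All other corners have positive angle.
By self-similarity the curve is therefore an arc as soon as the two kinds of scales are never equal,
and this arc is a `τ`-quasi-arc if and only if `max (r ^ m) ((2 / 3) ^ (2 * n + 5)) ^ τ` is bounded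
by a multiple of that difference. For `r = (2 / 3) ^ β` this condition measures how well `β` is
approximated by the fractions `(2 * n + 5) / m`, and a sparse sum `β` of powers of `1 / 2` attains
any prescribed quality of approximation.
-/

namespace RegularArc

section Curves

open scoped unitInterval NNReal

/-! ### Subdivision of the unit interval -/

section Subdivision

/-- The affine map of `[0, 1]` onto its `j`-th part, after division into `n` equal parts; the
projection to `[0, 1]` has no effect when `1 ≤ j ≤ n`. -/
noncomputable def subpart (n j : ℕ) (s : I) : I :=
  Set.projIcc 0 1 zero_le_one (((j : ℝ) - 1 + s) / n)

variable {n i j : ℕ} {s t : I}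

theorem continuous_subpart (n j : ℕ) : Continuous (subpart n j) := by
  unfold subpart
  fun_prop

theorem coe_subpart (hj : j ∈ Set.Icc 1 n) (s : I) :
    (subpart n j s : ℝ) = ((j : ℝ) - 1 + s) / n := by
  have hj1 : (1 : ℝ) ≤ j := by exact_mod_cast hj.1
  have hjn : (j : ℝ) ≤ n := by exact_mod_cast hj.2
  have hn : (0 : ℝ) < n := by linarith
  rw [subpart, Set.projIcc_of_mem]
  exact ⟨div_nonneg (by linarith [s.2.1]) hn.le, (div_le_one hn).2 (by linarith [s.2.2])⟩

theorem exists_subpart_eq (hn : 1 ≤ n) (x : I) : ∃ j ∈ Set.Icc 1 n, ∃ s, subpart n j s = x := by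
  have hn' : (0 : ℝ) < n := by exact_mod_cast hn
  rcases eq_or_ne x 0 with rfl | hx
  · have h1 : 1 ∈ Set.Icc 1 n := ⟨le_rfl, hn⟩
    exact ⟨1, h1, 0, Subtype.ext (by simp [coe_subpart h1])⟩
  have hpos : 0 < (n : ℝ) * x := mul_pos hn' (unitInterval.pos_iff_ne_zero.2 hx)
  have hmem : ⌈(n : ℝ) * x⌉₊ ∈ Set.Icc 1 n :=
    ⟨Nat.ceil_pos.2 hpos, Nat.ceil_le.2 (mul_le_of_le_one_right hn'.le x.2.2)⟩
  refine ⟨_, hmem, ⟨n * x - ⌈(n : ℝ) * x⌉₊ + 1, ?_, ?_⟩, Subtype.ext ?_⟩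
  · linarith [Nat.ceil_lt_add_one hpos.le]
  · linarith [Nat.le_ceil ((n : ℝ) * x)]
  · rw [coe_subpart hmem]
    field_simp
    ring

theorem subpart_lt_subpart_iff (hj : j ∈ Set.Icc 1 n) : subpart n j s < subpart n j t ↔ s < t := by
  have hn : (0 : ℝ) < n := by exact_mod_cast hj.1.trans hj.2
  rw [← Subtype.coe_lt_coe, coe_subpart hj, coe_subpart hj, div_lt_div_iff_of_pos_right hn,
    add_lt_add_iff_left, Subtype.coe_lt_coe]

theorem strictMono_subpart (hj : j ∈ Set.Icc 1 n) : StrictMono (subpart n j) :=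
  fun _ _ => (subpart_lt_subpart_iff hj).2

theorem one_div_le_subpart_sub (hi : 1 ≤ i) (hj : j ≤ n) (hij : i + 1 < j) (s t : I) :
    1 / (n : ℝ) ≤ subpart n j t - subpart n i s := by
  have hij' : (i : ℝ) + 1 + 1 ≤ j := by exact_mod_cast hij
  rw [coe_subpart ⟨by omega, hj⟩, coe_subpart ⟨hi, by omega⟩, ← sub_div]
  gcongr
  linarith [t.2.1, s.2.2]

theorem subpart_le_subpart (hi : 1 ≤ i) (hj : j ≤ n) (hij : i < j) (s t : I) :
    subpart n i s ≤ subpart n j t := by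
  have hij' : (i : ℝ) + 1 ≤ j := by exact_mod_cast hij
  rw [← Subtype.coe_le_coe, coe_subpart ⟨by omega, hj⟩, coe_subpart ⟨hi, by omega⟩]
  refine div_le_div_of_nonneg_right ?_ n.cast_nonneg
  linarith [t.2.1, s.2.2]

theorem subpart_one (hi : 1 ≤ i) (hin : i + 1 ≤ n) : subpart n i 1 = subpart n (i + 1) 0 := by
  apply Subtype.ext
  rw [coe_subpart ⟨hi, by omega⟩, coe_subpart ⟨by omega, hin⟩]
  simp

theorem subpart_first (hn : 1 ≤ n) : subpart n 1 0 = 0 :=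
  Subtype.ext (by simp [coe_subpart ⟨le_rfl, hn⟩])

theorem subpart_last (hn : 1 ≤ n) : subpart n n 1 = 1 := by
  have hn' : (n : ℝ) ≠ 0 := by positivity
  exact Subtype.ext (by simp [coe_subpart ⟨hn, le_rfl⟩, hn'])

theorem subpart_lt_subpart_succ_iff (hi : 1 ≤ i) (hin : i + 1 ≤ n) :
    subpart n i s < subpart n (i + 1) t ↔ s ≠ 1 ∨ t ≠ 0 := by
  have hi' : i ∈ Set.Icc 1 n := ⟨hi, by omega⟩
  have hi1 : i + 1 ∈ Set.Icc 1 n := ⟨by omega, hin⟩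
  refine ⟨fun h => ?_, fun h => ?_⟩
  · by_contra! hst
    rw [hst.1, hst.2, subpart_one hi hin] at h
    exact h.false
  rcases h with hs | ht
  · calc subpart n i s < subpart n i 1 :=
          strictMono_subpart hi' (unitInterval.lt_one_iff_ne_one.2 hs)
      _ ≤ subpart n (i + 1) t := subpart_le_subpart hi hin (Nat.lt_succ_self i) _ _
  · calc subpart n i s ≤ subpart n (i + 1) 0 := subpart_le_subpart hi hin (Nat.lt_succ_self i) _ _
      _ < subpart n (i + 1) t := strictMono_subpart hi1 (unitInterval.pos_iff_ne_zero.2 ht)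

theorem image_subpart_Icc (hj : j ∈ Set.Icc 1 n) :
    subpart n j '' Set.Icc s t = Set.Icc (subpart n j s) (subpart n j t) := by
  refine ((strictMono_subpart hj).monotone.mapsTo_Icc.image_subset).antisymm fun x hx => ?_
  have hst : s ≤ t := (strictMono_subpart hj).le_iff_le.1 (hx.1.trans hx.2)
  exact intermediate_value_Icc hst (continuous_subpart n j).continuousOn hx

theorem lt_induction (hn : 2 ≤ n) {p : I → I → Prop}
    (base : ∀ i j, 1 ≤ i → i < j → j ≤ n → ∀ s t, subpart n i s < subpart n j t →
      p (subpart n i s) (subpart n j t))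
    (step : ∀ j ∈ Set.Icc 1 n, ∀ s t, s < t → p s t → p (subpart n j s) (subpart n j t))
    (hst : s < t) : p s t := by
  obtain ⟨k, hk⟩ := exists_pow_lt_of_lt_one (sub_pos.2 hst : (0 : ℝ) < t - s) one_half_lt_one
  induction k generalizing s t with
  | zero => linarith [s.2.1, t.2.2, pow_zero (1 / 2 : ℝ)]
  | succ k ih =>
    obtain ⟨i, hi, s, rfl⟩ := exists_subpart_eq (by omega : 1 ≤ n) s
    obtain ⟨j, hj, t, rfl⟩ := exists_subpart_eq (by omega : 1 ≤ n) t
    rcases lt_trichotomy i j with hij | rfl | hji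
    · exact base i j hi.1 hij hj.2 s t hst
    · have hst' : s < t := (subpart_lt_subpart_iff hi).1 hst
      refine step i hi s t hst' (ih hst' ?_)
      have hn' : (2 : ℝ) ≤ n := by exact_mod_cast hn
      rw [coe_subpart hi, coe_subpart hi, ← sub_div, lt_div_iff₀ (by linarith)] at hk
      rw [pow_succ] at hk
      nlinarith [pow_pos (one_half_pos (α := ℝ)) k]
    · exact absurd hst (subpart_le_subpart hj.1 hi.2 hji t s).not_gt

theorem ne_zero_induction (hn : 2 ≤ n) {p : I → Prop}
    (base : ∀ j, 2 ≤ j → j ≤ n → ∀ t, p (subpart n j t))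
    (step : ∀ t, t ≠ 0 → p t → p (subpart n 1 t)) (ht : t ≠ 0) : p t := by
  refine lt_induction (p := fun s t => s = 0 → p t) hn
    (fun i j hi hij hj s t _ _ => base j (by omega) hj t) (fun j hj s t hst ih hs => ?_)
    (unitInterval.pos_iff_ne_zero.2 ht) rfl
  rcases hj.1.eq_or_lt with rfl | hj1
  · rw [← subpart_first hj.2] at hs
    exact step t (unitInterval.nonneg'.trans_lt hst).ne' (ih ((strictMono_subpart hj).injective hs))
  · exact base j hj1 hj.2 t

theorem ne_one_induction (hn : 2 ≤ n) {p : I → Prop}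
    (base : ∀ j, 1 ≤ j → j < n → ∀ t, p (subpart n j t))
    (step : ∀ t, t ≠ 1 → p t → p (subpart n n t)) (ht : t ≠ 1) : p t := by
  refine lt_induction (p := fun s t => t = 1 → p s) hn
    (fun i j hi hij hj s t _ _ => base i hi (by omega) s) (fun j hj s t hst ih ht => ?_)
    (unitInterval.lt_one_iff_ne_one.2 ht) rfl
  rcases hj.2.eq_or_lt with rfl | hjn
  · rw [← subpart_last hj.1] at ht
    exact step s (hst.trans_le unitInterval.le_one').ne (ih ((strictMono_subpart hj).injective ht))
  · exact base j hj.1 hjn s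

theorem eq_of_subpart_eq_of_lt (hi : 1 ≤ i) (hj : j ≤ n) (hij : i < j)
    (h : subpart n i s = subpart n j t) : j = i + 1 ∧ s = 1 ∧ t = 0 := by
  rcases (Nat.succ_le_of_lt hij).eq_or_lt with rfl | hij
  · have hst : ¬(s ≠ 1 ∨ t ≠ 0) := fun hst =>
      ((subpart_lt_subpart_succ_iff hi hj).2 hst).ne h
    exact ⟨rfl, by tauto⟩
  · have hgap := one_div_le_subpart_sub hi hj hij s t
    have hn : (0 : ℝ) < n := by exact_mod_cast (by omega : 0 < n)
    rw [h, sub_self] at hgap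
    exact absurd hgap (one_div_pos.2 hn).not_ge

theorem exists_continuousMap_subpart {X : Type*} [TopologicalSpace X] (hn : 1 ≤ n) {f : ℕ → I → X}
    (hf : ∀ j ∈ Set.Icc 1 n, Continuous (f j))
    (hglue : ∀ i, 1 ≤ i → i + 1 ≤ n → f i 1 = f (i + 1) 0) :
    ∃ g : C(I, X), ∀ j ∈ Set.Icc 1 n, ∀ s, g (subpart n j s) = f j s := by
  let q : Set.Icc 1 n × I → I := fun x => subpart n x.1 x.2
  let F : Set.Icc 1 n × I → X := fun x => f x.1 x.2
  have hqc : Continuous q := continuous_prod_of_discrete_left.2 fun j => continuous_subpart n j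
  have hFc : Continuous F := continuous_prod_of_discrete_left.2 fun j => hf j j.2
  have hq : Topology.IsQuotientMap q := hqc.isClosedMap.isQuotientMap hqc fun x =>
    let ⟨j, hj, s, hs⟩ := exists_subpart_eq hn x
    ⟨(⟨j, hj⟩, s), hs⟩
  have hlt : ∀ i j, 1 ≤ i → i < j → j ≤ n → ∀ s t, subpart n i s = subpart n j t →
      f i s = f j t := fun i j hi hij hj s t h => by
    obtain ⟨rfl, rfl, rfl⟩ := eq_of_subpart_eq_of_lt hi hj hij h
    exact hglue i hi hj
  have hF : Function.FactorsThrough F q := by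
    rintro ⟨⟨i, hi⟩, s⟩ ⟨⟨j, hj⟩, t⟩ (h : subpart n i s = subpart n j t)
    change f i s = f j t
    rcases lt_trichotomy i j with hij | rfl | hji
    · exact hlt i j hi.1 hij hj.2 s t h
    · rw [(strictMono_subpart hi).injective h]
    · exact (hlt j i hj.1 hji hi.2 t s h.symm).symm
  obtain ⟨g, hg⟩ : ∃ g : I → X, F = g ∘ q :=
    have : Nonempty X := ⟨f 1 0⟩
    (Function.factorsThrough_iff F).1 hF
  exact ⟨⟨g, hq.continuous_iff.2 (hg ▸ hFc)⟩, fun j hj s => (congrFun hg (⟨j, hj⟩, s)).symm⟩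

end Subdivision

/-! ### Self-similar curves -/

/-- The curve `γ` parametrizes the self-similar set of the maps `f 1, …, f n` in such a way that
`f j` corresponds to the affine map of `[0, 1]` onto its `j`-th part. -/
structure IsSelfSimilarCurve {E : Type*} [TopologicalSpace E] (n : ℕ) (f : ℕ → E → E)
    (γ : I → E) : Prop where
  continuous : Continuous γ
  semiconj : ∀ j ∈ Set.Icc 1 n, Function.Semiconj γ (subpart n j) (f j)

variable {E : Type*} [MetricSpace E] {n : ℕ} {f : ℕ → E → E} {γ : I → E}

theorem exists_isSelfSimilarCurve [CompleteSpace E] (hn : 1 ≤ n) {q : ℝ≥0} (hq : q < 1)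
    (hf : ∀ j ∈ Set.Icc 1 n, LipschitzWith q (f j)) {A : ℕ → E}
    (hfirst : ∀ j ∈ Set.Icc 1 n, f j (A 0) = A (j - 1))
    (hlast : ∀ j ∈ Set.Icc 1 n, f j (A n) = A j) {K : Set E} (hK : IsClosed K)
    (hmaps : ∀ j ∈ Set.Icc 1 n, Set.MapsTo (f j) K K) (hjoin : JoinedIn K (A 0) (A n)) :
    ∃ γ, IsSelfSimilarCurve n f γ ∧ γ 0 = A 0 ∧ γ 1 = A n ∧ ∀ s, γ s ∈ K := by
  let X : Set C(I, E) := {γ | γ 0 = A 0 ∧ γ 1 = A n ∧ ∀ s, γ s ∈ K}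
  have hXK : IsClosed {γ : C(I, E) | ∀ s, γ s ∈ K} := by
    simpa only [Set.mapsTo_univ_iff] using ContinuousMap.isClosed_setOfPred_mapsTo hK Set.univ
  have hX : IsClosed X :=
    (isClosed_eq (by fun_prop) continuous_const).inter
      ((isClosed_eq (by fun_prop) continuous_const).inter hXK)
  have hrefine : ∀ γ : X, ∃ γ' : X, ∀ j ∈ Set.Icc 1 n, ∀ s,
      γ'.1 (subpart n j s) = f j (γ.1 s) := by
    rintro ⟨γ, h0, h1, hγK⟩
    obtain ⟨γ', hγ'⟩ := exists_continuousMap_subpart hn (f := fun j s => f j (γ s))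
      (fun j hj => (hf j hj).continuous.comp γ.continuous) fun i hi hin => by
        rw [h0, h1, hlast i ⟨hi, by omega⟩, hfirst (i + 1) ⟨by omega, hin⟩, Nat.add_sub_cancel]
    refine ⟨⟨γ', ?_, ?_, fun x => ?_⟩, hγ'⟩
    · rw [← subpart_first hn, hγ' 1 ⟨le_rfl, hn⟩, h0, hfirst 1 ⟨le_rfl, hn⟩]
    · rw [← subpart_last hn, hγ' n ⟨hn, le_rfl⟩, h1, hlast n ⟨hn, le_rfl⟩]
    · obtain ⟨j, hj, s, rfl⟩ := exists_subpart_eq hn x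
      rw [hγ' j hj]
      exact hmaps j hj (hγK s)
  choose T hT using hrefine
  have hcontr : ContractingWith q T := by
    refine ⟨hq, LipschitzWith.of_dist_le_mul fun γ₁ γ₂ => ?_⟩
    refine (ContinuousMap.dist_le (by positivity)).2 fun x => ?_
    obtain ⟨j, hj, s, rfl⟩ := exists_subpart_eq hn x
    rw [hT γ₁ j hj, hT γ₂ j hj]
    exact ((hf j hj).dist_le_mul _ _).trans
      (mul_le_mul_of_nonneg_left (ContinuousMap.dist_apply_le_dist s) q.2)
  have : CompleteSpace X := hX.completeSpace_coe
  have : Nonempty X := ⟨hjoin.somePath, by simp, by simp, hjoin.somePath_mem⟩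
  obtain ⟨γ, hγ⟩ : ∃ γ, T γ = γ := ⟨_, hcontr.fixedPoint_isFixedPt⟩
  exact ⟨γ.1, ⟨γ.1.continuous, fun j hj s => by rw [← hT γ j hj s, hγ]⟩, γ.2⟩

namespace IsSelfSimilarCurve

theorem isSelfSimilarSet (hγ : IsSelfSimilarCurve n f γ) (hn : 1 ≤ n) :
    IsSelfSimilarSet n f (Set.range γ) where
  isCompact := isCompact_range hγ.continuous
  nonempty := Set.range_nonempty γ
  eq_iUnion := by
    ext z
    simp only [Set.mem_range, Set.mem_iUnion, Set.mem_image, exists_prop, exists_exists_eq_and]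
    constructor
    · rintro ⟨x, rfl⟩
      obtain ⟨j, hj, s, rfl⟩ := exists_subpart_eq hn x
      exact ⟨j, hj, s, (hγ.semiconj j hj s).symm⟩
    · rintro ⟨j, hj, s, rfl⟩
      exact ⟨_, hγ.semiconj j hj s⟩

theorem injective (hγ : IsSelfSimilarCurve n f γ) (hn : 2 ≤ n)
    (hinj : ∀ j ∈ Set.Icc 1 n, Function.Injective (f j))
    (hsep : ∀ i j, 1 ≤ i → i < j → j ≤ n → ∀ s t, subpart n i s < subpart n j t →
      f i (γ s) ≠ f j (γ t)) : Function.Injective γ := by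
  have hlt : ∀ s t, s < t → γ s ≠ γ t := fun s t => by
    refine lt_induction (p := fun s t => γ s ≠ γ t) hn (fun i j hi hij hj s t hst => ?_)
      fun j hj s t _ ih => ?_
    · rw [hγ.semiconj i ⟨hi, by omega⟩, hγ.semiconj j ⟨by omega, hj⟩]
      exact hsep i j hi hij hj s t hst
    · rw [hγ.semiconj j hj, hγ.semiconj j hj]
      exact (hinj j hj).ne ih
  intro s t hst
  by_contra hne
  rcases lt_or_gt_of_ne hne with h | h
  · exact hlt s t h hst
  · exact hlt t s h hst.symm

theorem isSelfSimilarArc (hγ : IsSelfSimilarCurve n f γ) (hn : 2 ≤ n)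
    (hinj : ∀ j ∈ Set.Icc 1 n, Function.Injective (f j))
    (hsep : ∀ i j, 1 ≤ i → i < j → j ≤ n → ∀ s t, subpart n i s < subpart n j t →
      f i (γ s) ≠ f j (γ t)) : IsSelfSimilarArc n f (Set.range γ) where
  toIsSelfSimilarSet := hγ.isSelfSimilarSet (by omega)
  isArc := ⟨γ, hγ.continuous, hγ.injective hn hinj hsep, rfl⟩
  inter_succ i hi hin := by
    have hcorner : f i (γ 1) = f (i + 1) (γ 0) := by
      rw [← hγ.semiconj i ⟨hi, by omega⟩, ← hγ.semiconj (i + 1) ⟨by omega, hin⟩,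
        subpart_one hi hin]
    refine ⟨f i (γ 1), Set.eq_singleton_iff_unique_mem.2
      ⟨⟨⟨_, ⟨1, rfl⟩, rfl⟩, ⟨_, ⟨0, rfl⟩, hcorner.symm⟩⟩, ?_⟩⟩
    rintro _ ⟨⟨_, ⟨s, rfl⟩, rfl⟩, ⟨_, ⟨t, rfl⟩, h⟩⟩
    have hst : ¬(s ≠ 1 ∨ t ≠ 0) := fun hst =>
      hsep i (i + 1) hi (Nat.lt_succ_self i) hin s t
        ((subpart_lt_subpart_succ_iff hi hin).2 hst) h.symm
    rw [show s = 1 by tauto]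
  disjoint i j hi hij hj := by
    rw [Set.disjoint_left]
    rintro _ ⟨_, ⟨s, rfl⟩, rfl⟩ ⟨_, ⟨t, rfl⟩, h⟩
    have hlt : subpart n i s < subpart n j t :=
      (subpart_le_subpart hi hj (by omega) s t).lt_of_ne fun hst => by
        have := (eq_of_subpart_eq_of_lt hi hj (by omega) hst).1
        omega
    exact hsep i j hi (by omega) hj s t hlt h.symm

end IsSelfSimilarCurve

/-! ### Quasi-arcs -/

theorem IsArcParam.isQuasiArc_iff {Λ : Set E} (hγ : IsArcParam Λ γ) {τ : ℝ} (hτ : 0 ≤ τ) :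
    IsQuasiArc τ Λ ↔ ∃ C : ℝ, 0 < C ∧
      ∀ s t, Metric.diam (γ '' Set.uIcc s t) ^ τ ≤ C * dist (γ s) (γ t) := by
  refine ⟨fun ⟨h, hh, C, hC, hhC⟩ => ⟨C, hC, fun s t => ?_⟩, fun ⟨C, hC, h⟩ => ⟨γ, hγ, C, hC, h⟩⟩
  obtain ⟨a, ha⟩ : γ s ∈ Set.range h := by rw [hh.range_eq, ← hγ.range_eq]; exact ⟨s, rfl⟩
  obtain ⟨b, hb⟩ : γ t ∈ Set.range h := by rw [hh.range_eq, ← hγ.range_eq]; exact ⟨t, rfl⟩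
  have hconn : IsPreconnected (γ ⁻¹' (h '' Set.uIcc a b)) := by
    refine (isPreconnected_uIcc.image h hh.continuous.continuousOn).preimage_of_isClosedMap
      hγ.injective hγ.continuous.isClosedMap ?_
    rw [hγ.range_eq, ← hh.range_eq]
    exact Set.image_subset_range _ _
  have hsub : γ '' Set.uIcc s t ⊆ h '' Set.uIcc a b := Set.image_subset_iff.2 <|
    hconn.ordConnected.uIcc_subset ⟨a, Set.left_mem_uIcc, ha⟩ ⟨b, Set.right_mem_uIcc, hb⟩
  have hbdd : Bornology.IsBounded (h '' Set.uIcc a b) :=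
    (isCompact_uIcc.image hh.continuous).isBounded
  rw [← ha, ← hb]
  exact (Real.rpow_le_rpow Metric.diam_nonneg (Metric.diam_mono hsub hbdd) hτ).trans (hhC a b)

/-- The quasi-arc inequality with exponent `τ` and constant `C` for the part of `γ` between the
parameters `s ≤ t`. -/
def TurnsWithin (γ : I → E) (τ C : ℝ) (s t : I) : Prop :=
  Metric.diam (γ '' Set.Icc s t) ^ τ ≤ C * dist (γ s) (γ t)

theorem diam_image_le_diam_range (hγ : Continuous γ) (s : Set I) :
    Metric.diam (γ '' s) ≤ Metric.diam (Set.range γ) :=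
  Metric.diam_mono (Set.image_subset_range _ _) (isCompact_range hγ).isBounded

theorem TurnsWithin.mono {τ C C' : ℝ} {s t : I} (h : TurnsWithin γ τ C s t) (hC : C ≤ C') :
    TurnsWithin γ τ C' s t :=
  h.trans (by gcongr)

theorem TurnsWithin.concat {τ C D : ℝ} {s u t : I} (hτ : 0 ≤ τ) (hD : 0 ≤ D) (hsu : s ≤ u)
    (hut : u ≤ t) (hleft : TurnsWithin γ 1 D s u) (hright : TurnsWithin γ 1 D u t)
    (hC : (dist (γ s) (γ u) + dist (γ u) (γ t)) ^ τ ≤ C * dist (γ s) (γ t)) :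
    TurnsWithin γ τ (D ^ τ * C) s t := by
  unfold TurnsWithin at hleft hright ⊢
  rw [Real.rpow_one] at hleft hright
  have hdiam : Metric.diam (γ '' Set.Icc s t) ≤ D * (dist (γ s) (γ u) + dist (γ u) (γ t)) := by
    rw [← Set.Icc_union_Icc_eq_Icc hsu hut, Set.image_union, mul_add]
    have hne : (γ '' Set.Icc s u ∩ γ '' Set.Icc u t).Nonempty :=
      ⟨γ u, ⟨u, Set.right_mem_Icc.2 hsu, rfl⟩, ⟨u, Set.left_mem_Icc.2 hut, rfl⟩⟩
    exact (Metric.diam_union' hne).trans (add_le_add hleft hright)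
  calc _ ≤ _ := Real.rpow_le_rpow Metric.diam_nonneg hdiam hτ
    _ = _ := Real.mul_rpow hD (by positivity)
    _ ≤ D ^ τ * _ := mul_le_mul_of_nonneg_left hC (by positivity)
    _ = _ := (mul_assoc _ _ _).symm

theorem isQuasiArc_range (hcont : Continuous γ) (hinj : Function.Injective γ) {τ C : ℝ}
    (hτ : 0 < τ) (h : ∀ s t, s < t → TurnsWithin γ τ C s t) : IsQuasiArc τ (Set.range γ) := by
  refine ⟨γ, ⟨hcont, hinj, rfl⟩, max C 1, by positivity, fun s t => ?_⟩
  wlog hst : s ≤ t generalizing s t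
  · rw [Set.uIcc_comm, dist_comm]
    exact this t s (le_of_not_ge hst)
  rw [Set.uIcc_of_le hst]
  rcases hst.eq_or_lt with rfl | hst
  · simp [Real.zero_rpow hτ.ne']
  · exact (h s t hst).mono (le_max_left C 1)

theorem exists_turnsWithin_of_add_le (hcont : Continuous γ) (hinj : Function.Injective γ)
    {τ ε : ℝ} (hτ : 0 ≤ τ) (hε : 0 < ε) :
    ∃ C, 0 ≤ C ∧ ∀ s t : I, ε ≤ t - s → TurnsWithin γ τ C s t := by
  have hcompact : IsCompact {p : I × I | ε ≤ (p.2 : ℝ) - p.1} :=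
    (isClosed_le continuous_const (by fun_prop)).isCompact
  obtain ⟨d, hd, hdist⟩ := hcompact.exists_forall_le' (f := fun p => dist (γ p.1) (γ p.2))
    (by fun_prop) (a := 0) fun p (hp : ε ≤ (p.2 : ℝ) - p.1) =>
      dist_pos.2 (hinj.ne fun h => by rw [h, sub_self] at hp; exact hε.not_ge hp)
  refine ⟨Metric.diam (Set.range γ) ^ τ / d, by positivity, fun s t hst => ?_⟩
  calc Metric.diam (γ '' Set.Icc s t) ^ τ
      ≤ Metric.diam (Set.range γ) ^ τ :=
        Real.rpow_le_rpow Metric.diam_nonneg (diam_image_le_diam_range hcont _) hτ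
    _ = Metric.diam (Set.range γ) ^ τ / d * d := (div_mul_cancel₀ _ hd.ne').symm
    _ ≤ _ := mul_le_mul_of_nonneg_left (hdist (s, t) hst) (by positivity)

namespace IsSelfSimilarCurve

variable {ρ : ℕ → ℝ≥0} {τ C : ℝ} {j : ℕ} {s t : I}

theorem turnsWithin_subpart (hγ : IsSelfSimilarCurve n f γ) (hj : j ∈ Set.Icc 1 n)
    (hf : ∀ x y, dist (f j x) (f j y) = ρ j * dist x y) (hρ : ρ j ≤ 1) (hτ : 1 ≤ τ)
    (h : TurnsWithin γ τ C s t) : TurnsWithin γ τ C (subpart n j s) (subpart n j t) := by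
  have hdiam : Metric.diam (γ '' Set.Icc (subpart n j s) (subpart n j t)) ≤
      ρ j * Metric.diam (γ '' Set.Icc s t) := by
    rw [← image_subpart_Icc hj, ← Set.image_comp, (hγ.semiconj j hj).comp_eq, Set.image_comp]
    exact (LipschitzWith.of_dist_le_mul fun x y => (hf x y).le).diam_image_le _
      (isCompact_Icc.image hγ.continuous).isBounded
  have hdiam0 : 0 ≤ Metric.diam (γ '' Set.Icc s t) := Metric.diam_nonneg
  unfold TurnsWithin at h ⊢
  rw [hγ.semiconj j hj, hγ.semiconj j hj, hf]
  calc _ ≤ (ρ j * Metric.diam (γ '' Set.Icc s t)) ^ τ :=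
        Real.rpow_le_rpow Metric.diam_nonneg hdiam (by linarith)
    _ = ρ j ^ τ * Metric.diam (γ '' Set.Icc s t) ^ τ := Real.mul_rpow (ρ j).2 hdiam0
    _ ≤ ρ j * (C * dist (γ s) (γ t)) := by
        gcongr
        exact Real.rpow_le_self_of_le_one (ρ j).2 hρ hτ
    _ = C * (ρ j * dist (γ s) (γ t)) := by ring

section

variable (hγ : IsSelfSimilarCurve n f γ) (hn : 2 ≤ n) (hinj : Function.Injective γ)
  (hf : ∀ j ∈ Set.Icc 1 n, ∀ x y, dist (f j x) (f j y) = ρ j * dist x y)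
  (hρ : ∀ j ∈ Set.Icc 1 n, ρ j ≤ 1)
include hγ hn hinj hf hρ

theorem exists_turnsWithin_zero :
    ∃ C, 0 ≤ C ∧ ∀ t, TurnsWithin γ 1 C 0 t := by
  have hn' : (0 : ℝ) < n := by positivity
  obtain ⟨C, hC0, hC⟩ := exists_turnsWithin_of_add_le hγ.continuous hinj zero_le_one
    (one_div_pos.2 hn')
  refine ⟨C, hC0, fun t => ?_⟩
  rcases eq_or_ne t 0 with rfl | ht
  · simp [TurnsWithin]
  refine ne_zero_induction (p := TurnsWithin γ 1 C 0) hn (fun j hj hjn t => hC _ _ ?_)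
    (fun t _ ih => ?_) ht
  · have hj' : (2 : ℝ) ≤ j := by exact_mod_cast hj
    rw [coe_subpart ⟨by omega, hjn⟩, Set.Icc.coe_zero, sub_zero]
    exact div_le_div_of_nonneg_right (by linarith [t.2.1]) hn'.le
  · have h1 : 1 ∈ Set.Icc 1 n := ⟨le_rfl, by omega⟩
    simpa only [subpart_first h1.2] using
      hγ.turnsWithin_subpart h1 (hf 1 h1) (hρ 1 h1) le_rfl ih

theorem exists_turnsWithin_one :
    ∃ C, 0 ≤ C ∧ ∀ s, TurnsWithin γ 1 C s 1 := by
  have hn' : (0 : ℝ) < n := by positivity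
  obtain ⟨C, hC0, hC⟩ := exists_turnsWithin_of_add_le hγ.continuous hinj zero_le_one
    (one_div_pos.2 hn')
  refine ⟨C, hC0, fun s => ?_⟩
  rcases eq_or_ne s 1 with rfl | hs
  · simp [TurnsWithin]
  refine ne_one_induction (p := fun s => TurnsWithin γ 1 C s 1) hn (fun j hj hjn s => hC _ _ ?_)
    (fun s _ ih => ?_) hs
  · have hj' : (j : ℝ) + 1 ≤ n := by exact_mod_cast hjn
    rw [coe_subpart ⟨hj, hjn.le⟩, Set.Icc.coe_one, one_sub_div hn'.ne']
    exact div_le_div_of_nonneg_right (by linarith [s.2.2]) hn'.le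
  · have h1 : n ∈ Set.Icc 1 n := ⟨by omega, le_rfl⟩
    simpa only [subpart_last h1.1] using
      hγ.turnsWithin_subpart h1 (hf n h1) (hρ n h1) le_rfl ih

theorem isQuasiArc (hτ : 1 ≤ τ)
    (hcorner : ∃ C, ∀ i, 1 ≤ i → i + 1 ≤ n → ∀ s t,
      (dist (f i (γ s)) (f i (γ 1)) + dist (f i (γ 1)) (f (i + 1) (γ t))) ^ τ ≤
        C * dist (f i (γ s)) (f (i + 1) (γ t))) : IsQuasiArc τ (Set.range γ) := by
  have hn' : (0 : ℝ) < n := by positivity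
  obtain ⟨C₀, hC₀, hinit⟩ := hγ.exists_turnsWithin_zero hn hinj hf hρ
  obtain ⟨C₁, -, hterm⟩ := hγ.exists_turnsWithin_one hn hinj hf hρ
  obtain ⟨C₂, -, hfar⟩ := exists_turnsWithin_of_add_le hγ.continuous hinj (τ := τ) (by linarith)
    (one_div_pos.2 hn')
  obtain ⟨C, hC⟩ := hcorner
  let D := max C₀ C₁
  have hD : 0 ≤ D := hC₀.trans (le_max_left _ _)
  have hadj : ∀ i, 1 ≤ i → i + 1 ≤ n → ∀ s t,
      TurnsWithin γ τ (D ^ τ * C) (subpart n i s) (subpart n (i + 1) t) := by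
    intro i hi hin s t
    have hi' : i ∈ Set.Icc 1 n := ⟨hi, by omega⟩
    have hi1 : i + 1 ∈ Set.Icc 1 n := ⟨by omega, hin⟩
    have hleft := hγ.turnsWithin_subpart hi' (hf i hi') (hρ i hi') le_rfl (hterm s)
    have hright := hγ.turnsWithin_subpart hi1 (hf _ hi1) (hρ _ hi1) le_rfl (hinit t)
    rw [← subpart_one hi hin] at hright
    refine (hleft.mono (le_max_right _ _)).concat (by linarith) hD
      ((strictMono_subpart hi').monotone unitInterval.le_one')
      (subpart_le_subpart hi hin (Nat.lt_succ_self i) 1 t) (hright.mono (le_max_left _ _)) ?_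
    rw [hγ.semiconj i hi', hγ.semiconj i hi', hγ.semiconj _ hi1]
    exact hC i hi hin s t
  refine isQuasiArc_range hγ.continuous hinj (by linarith) (C := max C₂ (D ^ τ * C))
    fun s t hst => lt_induction (p := TurnsWithin γ τ _) hn (fun i j hi hij hj s t _ => ?_)
      (fun j hj s t _ ih => hγ.turnsWithin_subpart hj (hf j hj) (hρ j hj) hτ ih) hst
  rcases (Nat.succ_le_of_lt hij).eq_or_lt with rfl | hij
  · exact (hadj i hi hj s t).mono (le_max_right _ _)
  · exact (hfar _ _ (one_div_le_subpart_sub hi hj hij s t)).mono (le_max_left _ _)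

end

end IsSelfSimilarCurve

end Curves

section CornerBound

open Filter Real

/-! ### The corner bound and dyadic approximation -/

/-- The ratios of the last piece for which the first two pieces meet only in their common corner:
`r ^ m` and `(2 / 3) ^ (2 * n + 5)` are the scales of the subpieces approaching that corner from
its two sides. -/
structure IsAdmissibleRatio (r : ℝ) : Prop where
  one_third_lt : 1 / 3 < r
  lt_four_ninths : r < 4 / 9
  pow_ne : ∀ m n : ℕ, r ^ m ≠ (2 / 3) ^ (2 * n + 5)

/-- The scales `r ^ m` and `(2 / 3) ^ (2 * n + 5)` differ by at least a multiple of the `τ`-th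
power of the larger one. -/
def HasCornerBound (τ r : ℝ) : Prop :=
  ∃ C : ℝ, ∀ m n : ℕ,
    max (r ^ m) ((2 / 3) ^ (2 * n + 5)) ^ τ ≤ C * |r ^ m - (2 / 3) ^ (2 * n + 5)|

section Exp

variable {x y τ D : ℝ}

theorem abs_exp_sub_exp_le (x y : ℝ) : |exp x - exp y| ≤ max (exp x) (exp y) * |x - y| := by
  wlog hxy : x ≤ y generalizing x y
  · rw [abs_sub_comm, max_comm, abs_sub_comm x]
    exact this y x (le_of_not_ge hxy)
  rw [max_eq_right (exp_le_exp.2 hxy), abs_sub_comm, abs_sub_comm x,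
    abs_of_nonneg (sub_nonneg.2 (exp_le_exp.2 hxy)), abs_of_nonneg (sub_nonneg.2 hxy)]
  have hexp : exp x = exp y * exp (x - y) := by rw [← exp_add, add_sub_cancel]
  nlinarith [add_one_le_exp (x - y), exp_pos y]

theorem max_exp_mul_abs_sub_le (x y : ℝ) :
    max (exp x) (exp y) * |x - y| ≤ (1 + |x - y|) * |exp x - exp y| := by
  wlog hxy : x ≤ y generalizing x y
  · rw [abs_sub_comm, max_comm, abs_sub_comm (exp x)]
    exact this y x (le_of_not_ge hxy)
  rw [max_eq_right (exp_le_exp.2 hxy), abs_sub_comm, abs_sub_comm (exp x),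
    abs_of_nonneg (sub_nonneg.2 (exp_le_exp.2 hxy)), abs_of_nonneg (sub_nonneg.2 hxy)]
  have hexp : exp y = exp x * exp (y - x) := by rw [← exp_add, add_sub_cancel]
  nlinarith [add_one_le_exp (y - x), exp_pos x]

theorem exp_neg_le_of_max_rpow_le (hτ : 1 ≤ τ)
    (h : max (exp (-x)) (exp (-y)) ^ τ ≤ D * |exp (-x) - exp (-y)|) :
    exp (-((τ - 1) * y)) ≤ D * |x - y| := by
  set M := max (exp (-x)) (exp (-y))
  have hM : 0 < M := (exp_pos _).trans_le (le_max_left _ _)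
  have hD : 0 ≤ D := by
    by_contra! hD
    exact (rpow_pos_of_pos hM τ).not_ge
      (h.trans (mul_nonpos_of_nonpos_of_nonneg hD.le (abs_nonneg _)))
  have hxy : |-x - -y| = |x - y| := by rw [neg_sub_neg, abs_sub_comm]
  refine le_of_mul_le_mul_left ?_ hM
  calc M * exp (-((τ - 1) * y)) = M * exp (-y) ^ (τ - 1) := by rw [← exp_mul]; ring_nf
    _ ≤ M * M ^ (τ - 1) := by
        gcongr
        exact le_max_right _ _
    _ = M ^ τ := by rw [rpow_sub_one hM.ne', mul_div_cancel₀ _ hM.ne']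
    _ ≤ D * (M * |x - y|) := h.trans (mul_le_mul_of_nonneg_left
        ((abs_exp_sub_exp_le _ _).trans_eq (by rw [hxy])) hD)
    _ = M * (D * |x - y|) := by ring

theorem max_rpow_le_of_exp_neg_le (hx : 0 ≤ x) (hy : 0 ≤ y) (hτ : 1 ≤ τ)
    (h : exp (-((τ - 1) * x)) ≤ D * |x - y|) :
    max (exp (-x)) (exp (-y)) ^ τ ≤ 2 * (1 + exp (τ - 1) * D) * |exp (-x) - exp (-y)| := by
  set M := max (exp (-x)) (exp (-y))
  set δ := |x - y|
  have hM : 0 < M := (exp_pos _).trans_le (le_max_left _ _)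
  have hM1 : M ≤ 1 := max_le (exp_le_one_iff.2 (by linarith)) (exp_le_one_iff.2 (by linarith))
  have hδ : 0 < δ := (abs_nonneg _).lt_of_ne fun h0 => by
    rw [show δ = 0 from h0.symm, mul_zero] at h
    exact (exp_pos _).not_ge h
  have hD : 0 ≤ D := (pos_of_mul_pos_left ((exp_pos _).trans_le h) hδ.le).le
  have hmain : M * δ ≤ (1 + δ) * |exp (-x) - exp (-y)| := by
    simpa only [neg_sub_neg, abs_sub_comm y x] using max_exp_mul_abs_sub_le (-x) (-y)
  have hdiff : 0 ≤ |exp (-x) - exp (-y)| := abs_nonneg _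
  have hMτ : M ^ τ = M * M ^ (τ - 1) := by rw [rpow_sub_one hM.ne', mul_div_cancel₀ _ hM.ne']
  rcases le_total 1 δ with hδ1 | hδ1
  · have hle : M ≤ 2 * |exp (-x) - exp (-y)| := by
      refine le_of_mul_le_mul_right ?_ hδ
      nlinarith
    calc M ^ τ ≤ M := rpow_le_self_of_le_one hM.le hM1 hτ
      _ ≤ 2 * |exp (-x) - exp (-y)| := hle
      _ ≤ _ := by
        gcongr
        exact le_mul_of_one_le_right zero_le_two (le_add_of_nonneg_right (by positivity))
  · have hMle : M ≤ exp (1 - x) := max_le (exp_le_exp.2 (by linarith))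
      (exp_le_exp.2 (by linarith [le_abs_self (x - y)]))
    have hpow : M ^ (τ - 1) ≤ exp (τ - 1) * (D * δ) :=
      calc M ^ (τ - 1) ≤ exp (1 - x) ^ (τ - 1) := by
            gcongr
        _ = exp (τ - 1) * exp (-((τ - 1) * x)) := by rw [← exp_mul, ← exp_add]; ring_nf
        _ ≤ _ := by gcongr
    calc M ^ τ ≤ M * (exp (τ - 1) * (D * δ)) := by rw [hMτ]; gcongr
      _ = exp (τ - 1) * D * (M * δ) := by ring
      _ ≤ exp (τ - 1) * D * ((1 + δ) * |exp (-x) - exp (-y)|) := by gcongr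
      _ ≤ _ := by
        have : 0 ≤ exp (τ - 1) * D := by positivity
        nlinarith [mul_nonneg this hdiff, mul_nonneg (mul_nonneg this hdiff) (sub_nonneg.2 hδ1)]

end Exp

/-- `β` is approximated from below by the dyadic numbers `p k / 2 ^ a k`, with an error governed by
the next denominator; as the numerators are odd, `β` is far from all other fractions with
denominator below `2 ^ a k`. -/
structure IsDyadicApprox (a p : ℕ → ℕ) (β : ℝ) : Prop where
  pos : ∀ k, 0 < a k
  le_succ : ∀ k, 2 * a k + 2 ≤ a (k + 1)
  odd : ∀ k, Odd (p k)
  two_pow_le : ∀ k, 2 ^ (a k + 1) ≤ p k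
  le_mul : ∀ k, (p k : ℝ) ≤ β * 2 ^ a k
  mul_le : ∀ k, β * 2 ^ a k ≤ p k + 2 * 2 ^ a k / 2 ^ a (k + 1)
  le_five_halves : β ≤ 5 / 2

theorem exists_mem_Icc_add_two_div {a : ℕ → ℕ} {x : ℕ → ℝ} (ha : ∀ k, a k < a (k + 1))
    (hx : ∀ k, x (k + 1) = x k + 1 / 2 ^ a (k + 1)) :
    ∃ β, ∀ k, β ∈ Set.Icc (x k) (x k + 2 / 2 ^ a (k + 1)) := by
  have hmono : Monotone x := monotone_nat_of_le_succ fun k => by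
    rw [hx]
    exact le_add_of_nonneg_right (by positivity)
  have hanti : Antitone fun k => x k + 2 / 2 ^ a (k + 1) := antitone_nat_of_succ_le fun k => by
    have hpow : (2 : ℝ) * 2 ^ a (k + 1) ≤ 2 ^ a (k + 2) := by
      rw [← pow_succ']
      exact pow_le_pow_right₀ one_le_two (ha (k + 1))
    have hlast : (2 : ℝ) / 2 ^ a (k + 2) ≤ 1 / 2 ^ a (k + 1) := by
      rwa [div_le_div_iff₀ (by positivity) (by positivity), one_mul]
    calc x (k + 1) + 2 / 2 ^ a (k + 2) ≤ x k + 1 / 2 ^ a (k + 1) + 1 / 2 ^ a (k + 1) := by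
          rw [hx]; gcongr
      _ = x k + 2 / 2 ^ a (k + 1) := by ring
  exact ⟨_, Set.mem_iInter.1 (hmono.ciSup_mem_iInter_Icc_of_antitone hanti fun k =>
    le_add_of_nonneg_right (by positivity))⟩

theorem exists_isDyadicApprox {F : ℕ → ℕ → ℕ} (hF : ∀ a p, 2 * a + 2 ≤ F a p) :
    ∃ a p β, IsDyadicApprox a p β ∧ ∀ k, a (k + 1) = F (a k) (p k) := by
  let g : ℕ → ℕ × ℕ := fun k =>
    k.rec (2, 9) fun _ x => (F x.1 x.2, x.2 * 2 ^ (F x.1 x.2 - x.1) + 1)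
  let a k := (g k).1
  let p k := (g k).2
  have hle : ∀ k, 2 * a k + 2 ≤ a (k + 1) := fun k => hF _ _
  have hsub : ∀ k, a (k + 1) - a k ≠ 0 := fun k => by have := hle k; omega
  have hpow : ∀ k, 2 ^ a (k + 1) = 2 ^ a k * 2 ^ (a (k + 1) - a k) := fun k => by
    rw [← pow_add, Nat.add_sub_cancel' (by linarith [hle k])]
  have hp : ∀ k, p (k + 1) = p k * 2 ^ (a (k + 1) - a k) + 1 := fun _ => rfl
  have hpos : ∀ k, 0 < a k := fun
    | 0 => two_pos
    | k + 1 => (Nat.succ_pos _).trans_le (hle k)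
  have hodd : ∀ k, Odd (p k) := fun
    | 0 => ⟨4, rfl⟩
    | k + 1 => hp k ▸ ((Nat.even_pow.2 ⟨even_two, hsub k⟩).mul_left _).add_one
  have htwo : ∀ k, 2 ^ (a k + 1) ≤ p k := fun k => by
    induction k with
    | zero => exact show 2 ^ (2 + 1) ≤ 9 by norm_num
    | succ k ih =>
      rw [hp, pow_succ, hpow, mul_right_comm, ← pow_succ]
      exact (Nat.mul_le_mul_right _ ih).trans (Nat.le_succ _)
  obtain ⟨β, hβ⟩ := exists_mem_Icc_add_two_div (a := a) (x := fun k => p k / 2 ^ a k)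
    (fun k => by linarith [hle k]) fun k => by
      have hpow' : (2 : ℝ) ^ a (k + 1) = 2 ^ a k * 2 ^ (a (k + 1) - a k) := mod_cast hpow k
      rw [hp, hpow']
      push_cast
      field_simp
  refine ⟨a, p, β, ⟨hpos, hle, hodd, htwo, fun k => ?_, fun k => ?_, ?_⟩, fun _ => rfl⟩
  · exact (div_le_iff₀ (by positivity)).1 (hβ k).1
  · calc β * 2 ^ a k ≤ (p k / 2 ^ a k + 2 / 2 ^ a (k + 1)) * 2 ^ a k := by gcongr; exact (hβ k).2
      _ = p k + 2 * 2 ^ a k / 2 ^ a (k + 1) := by field_simp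
  · have hsix : (2 : ℝ) ^ 6 ≤ 2 ^ a 1 := pow_le_pow_right₀ one_le_two (hF 2 9)
    calc β ≤ 9 / 2 ^ 2 + 2 / 2 ^ a 1 := (hβ 0).2
      _ ≤ 9 / 2 ^ 2 + 2 / 2 ^ 6 := by gcongr
      _ ≤ 5 / 2 := by norm_num

theorem log_three_halves_pos : 0 < log (3 / 2) := log_pos (by norm_num)

theorem two_thirds_rpow (x : ℝ) : (2 / 3 : ℝ) ^ x = exp (-(log (3 / 2) * x)) := by
  rw [rpow_def_of_pos (by norm_num), ← inv_div, log_inv, neg_mul]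

theorem hasCornerBound_two_thirds_rpow_iff {τ β : ℝ} :
    HasCornerBound τ ((2 / 3) ^ β) ↔ ∃ C : ℝ, ∀ m n : ℕ,
      max (exp (-(log (3 / 2) * (β * m)))) (exp (-(log (3 / 2) * ((2 * n + 5 : ℕ) : ℝ)))) ^ τ ≤
        C * |exp (-(log (3 / 2) * (β * m))) - exp (-(log (3 / 2) * ((2 * n + 5 : ℕ) : ℝ)))| := by
  simp only [HasCornerBound, ← two_thirds_rpow, rpow_mul (by norm_num : (0 : ℝ) ≤ 2 / 3),
    rpow_natCast]

namespace IsDyadicApprox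

variable {a p : ℕ → ℕ} {β τ : ℝ}

theorem le_index (h : IsDyadicApprox a p β) (k : ℕ) : k ≤ a k := by
  induction k with
  | zero => exact zero_le
  | succ k ih => linarith [h.le_succ k]

theorem two_pow_lt (h : IsDyadicApprox a p β) (k : ℕ) : 2 ^ (a k + 1) < p k :=
  (h.two_pow_le k).lt_of_ne fun heq => Nat.not_even_iff_odd.2 (h.odd k) <|
    heq ▸ (even_two.pow_of_ne_zero (Nat.succ_ne_zero _))

theorem two_pow_le_cast (h : IsDyadicApprox a p β) (k : ℕ) : (2 : ℝ) ^ a k ≤ p k := by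
  exact_mod_cast (pow_le_pow_right₀ one_le_two (Nat.le_succ _)).trans (h.two_pow_le k)

theorem two_pow_le_sq (h : IsDyadicApprox a p β) (k : ℕ) :
    (2 : ℝ) ^ (2 * a k + 2) ≤ (p k : ℝ) ^ 2 := by
  rw [← mul_add_one, mul_comm, pow_mul]
  exact_mod_cast Nat.pow_le_pow_left (h.two_pow_le k) 2

theorem tendsto_numerator (h : IsDyadicApprox a p β) :
    Tendsto (fun k => (p k : ℝ)) atTop atTop :=
  tendsto_atTop_mono (fun k => (by
    exact_mod_cast (h.le_index k).trans Nat.lt_two_pow_self.le : (k : ℝ) ≤ 2 ^ a k).trans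
      (h.two_pow_le_cast k)) tendsto_natCast_atTop_atTop

theorem two_lt (h : IsDyadicApprox a p β) : 2 < β := by
  have hlt : (2 : ℝ) ^ (a 0 + 1) < p 0 := mod_cast h.two_pow_lt 0
  rw [pow_succ'] at hlt
  exact lt_of_mul_lt_mul_right (hlt.trans_le (h.le_mul 0)) (by positivity)

theorem exists_numerator_eq (h : IsDyadicApprox a p β) (k : ℕ) : ∃ n, p k = 2 * n + 5 := by
  have htwo : 2 ^ 2 ≤ 2 ^ (a k + 1) := Nat.pow_le_pow_right two_pos (Nat.succ_le_succ (h.pos k))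
  obtain ⟨b, hb⟩ := h.odd k
  exact ⟨b - 2, by linarith [h.two_pow_lt k, Nat.sub_add_cancel (by
    linarith [h.two_pow_lt k] : 2 ≤ b)]⟩

theorem mul_error_le (h : IsDyadicApprox a p β) {k m : ℕ} (hm : m < 2 ^ a k) :
    m * (β * 2 ^ a k - p k) ≤ 1 / 2 := by
  have hpow : (4 : ℝ) * (2 ^ a k * 2 ^ a k) ≤ 2 ^ a (k + 1) :=
    calc (4 : ℝ) * (2 ^ a k * 2 ^ a k) = 2 ^ (2 * a k + 2) := by ring
      _ ≤ 2 ^ a (k + 1) := pow_le_pow_right₀ one_le_two (h.le_succ k)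
  calc m * (β * 2 ^ a k - p k) ≤ 2 ^ a k * (2 * 2 ^ a k / 2 ^ a (k + 1)) := by
        gcongr
        · exact sub_nonneg.2 (h.le_mul k)
        · exact_mod_cast hm.le
        · linarith [h.mul_le k]
    _ ≤ 1 / 2 := by
        rw [← mul_div_assoc, div_le_iff₀ (by positivity)]
        linarith

theorem one_div_le_abs_sub (h : IsDyadicApprox a p β) {k m N : ℕ} (hm : m < 2 ^ a k)
    (hN : N ≠ 0) : 1 / (2 * 2 ^ a k) ≤ |β * m - N| := by
  have hne : (m * p k - N * 2 ^ a k : ℤ) ≠ 0 := fun h0 => by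
    have heq : m * p k = N * 2 ^ a k := by exact_mod_cast sub_eq_zero.1 h0
    have hdvd : 2 ^ a k ∣ m :=
      ((Nat.coprime_two_left.2 (h.odd k)).pow_left _).dvd_of_dvd_mul_right ⟨N, by linarith⟩
    rw [Nat.eq_zero_of_dvd_of_lt hdvd hm, zero_mul] at heq
    exact mul_ne_zero hN (by positivity) heq.symm
  have herr : |m * (β * 2 ^ a k - p k)| ≤ 1 / 2 := by
    rw [abs_of_nonneg (mul_nonneg (Nat.cast_nonneg _) (sub_nonneg.2 (h.le_mul k)))]
    exact h.mul_error_le hm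
  have hone : 1 ≤ |β * m - N| * 2 ^ a k + 1 / 2 :=
    calc (1 : ℝ) ≤ |m * (p k : ℝ) - N * 2 ^ a k| := by exact_mod_cast Int.one_le_abs hne
      _ = |(β * m - N) * 2 ^ a k - m * (β * 2 ^ a k - p k)| := by ring_nf
      _ ≤ |(β * m - N) * 2 ^ a k| + |m * (β * 2 ^ a k - p k)| := abs_sub _ _
      _ ≤ |β * m - N| * 2 ^ a k + 1 / 2 := by
        rw [abs_mul, abs_of_pos (by positivity : (0 : ℝ) < 2 ^ a k)]
        gcongr
  rw [div_le_iff₀ (by positivity)]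
  linarith

theorem isAdmissibleRatio (h : IsDyadicApprox a p β) : IsAdmissibleRatio ((2 / 3) ^ β) where
  one_third_lt := by
    have hsq : ((1 : ℝ) / 3) ^ 2 < ((2 / 3) ^ (5 / 2 : ℝ)) ^ 2 := by
      rw [← rpow_natCast ((2 / 3 : ℝ) ^ (5 / 2 : ℝ)), ← rpow_mul (by norm_num)]
      norm_num
    exact (lt_of_pow_lt_pow_left₀ 2 (by positivity) hsq).trans_le
      (rpow_le_rpow_of_exponent_ge (by norm_num) (by norm_num) h.le_five_halves)
  lt_four_ninths :=
    calc (2 / 3 : ℝ) ^ β < (2 / 3) ^ (2 : ℝ) :=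
          rpow_lt_rpow_of_exponent_gt (by norm_num) (by norm_num) h.two_lt
      _ = 4 / 9 := by norm_num
  pow_ne m n heq := by
    have hβ : β * m = (2 * n + 5 : ℕ) := by
      rw [← rpow_natCast, ← rpow_natCast, ← rpow_mul (by norm_num), two_thirds_rpow,
        two_thirds_rpow, exp_eq_exp, neg_inj] at heq
      exact mul_left_cancel₀ log_three_halves_pos.ne' heq
    have hm : m < 2 ^ a m := Nat.lt_two_pow_self.trans_le (Nat.pow_le_pow_right two_pos
      (h.le_index m))
    have hle := h.one_div_le_abs_sub hm (N := 2 * n + 5) (by positivity)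
    rw [hβ, sub_self, abs_zero] at hle
    exact hle.not_gt (by positivity)

theorem hasCornerBound (h : IsDyadicApprox a p β) (hτ : 1 ≤ τ) {C : ℝ}
    (hC : ∀ k, 2 ^ a (k + 1) ≤ C * exp ((τ - 1) * (log (3 / 2) * p k))) :
    HasCornerBound τ ((2 / 3) ^ β) := by
  set κ := log (3 / 2)
  have hκ : 0 < κ := log_three_halves_pos
  set E := max (2 ^ a 0) C
  have hdecay : ∀ m : ℕ, ∃ k, m < 2 ^ a k ∧ exp (-((τ - 1) * (κ * (β * m)))) * 2 ^ a k ≤ E := by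
    intro m
    classical
    have hex : ∃ k, m < 2 ^ a k :=
      ⟨m, Nat.lt_two_pow_self.trans_le (Nat.pow_le_pow_right two_pos (h.le_index m))⟩
    refine ⟨_, Nat.find_spec hex, ?_⟩
    rcases hk : Nat.find hex with _ | k
    · refine (mul_le_of_le_one_left (by positivity) (exp_le_one_iff.2 ?_)).trans (le_max_left _ _)
      have := h.two_lt
      have : 0 ≤ (τ - 1) * (κ * (β * m)) := mul_nonneg (sub_nonneg.2 hτ) (by positivity)
      linarith
    · have hkm : (2 : ℝ) ^ a k ≤ m := by
        exact_mod_cast not_lt.1 (Nat.find_min hex (by simp only [hk, Nat.lt_succ_self]))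
      have hp : (p k : ℝ) ≤ β * m := (h.le_mul k).trans
        (mul_le_mul_of_nonneg_left hkm (by linarith [h.two_lt]))
      calc exp (-((τ - 1) * (κ * (β * m)))) * 2 ^ a (k + 1)
          ≤ exp (-((τ - 1) * (κ * p k))) * (C * exp ((τ - 1) * (κ * p k))) := by
            gcongr
            exact hC k
        _ = C := by rw [mul_left_comm, ← exp_add, neg_add_cancel, exp_zero, mul_one]
        _ ≤ E := le_max_right _ _
  refine hasCornerBound_two_thirds_rpow_iff.2 ⟨_, fun m n => max_rpow_le_of_exp_neg_le
    (D := 2 * E / κ) (by have := h.two_lt; positivity) (by positivity) hτ ?_⟩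
  obtain ⟨k, hmk, hE⟩ := hdecay m
  have hgap := h.one_div_le_abs_sub hmk (N := 2 * n + 5) (by positivity)
  rw [← mul_sub, abs_mul, abs_of_pos hκ]
  calc exp (-((τ - 1) * (κ * (β * m)))) ≤ E / 2 ^ a k := (le_div_iff₀ (by positivity)).2 hE
    _ = 2 * E / κ * (κ * (1 / (2 * 2 ^ a k))) := by field_simp
    _ ≤ _ := by gcongr

theorem exists_two_pow_le (h : IsDyadicApprox a p β) (hτ : 1 ≤ τ)
    (hbound : HasCornerBound τ ((2 / 3) ^ β)) :
    ∃ C, ∀ k, 2 ^ a (k + 1) ≤ C * 2 ^ a k * exp ((τ - 1) * (log (3 / 2) * p k)) := by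
  obtain ⟨D, hD⟩ := hasCornerBound_two_thirds_rpow_iff.1 hbound
  set κ := log (3 / 2)
  have hκ : 0 < κ := log_three_halves_pos
  refine ⟨2 * |D| * κ, fun k => ?_⟩
  obtain ⟨n, hn⟩ := h.exists_numerator_eq k
  have hle := exp_neg_le_of_max_rpow_le hτ (hD (2 ^ a k) n)
  have herr : |κ * (β * (2 ^ a k : ℕ)) - κ * p k| ≤ κ * (2 * 2 ^ a k / 2 ^ a (k + 1)) := by
    push_cast
    rw [← mul_sub, abs_mul, abs_of_pos hκ, abs_of_nonneg (sub_nonneg.2 (h.le_mul k))]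
    gcongr
    linarith [h.mul_le k]
  rw [← hn] at hle
  calc (2 : ℝ) ^ a (k + 1)
      = exp (-((τ - 1) * (κ * p k))) * (2 ^ a (k + 1) * exp ((τ - 1) * (κ * p k))) := by
        rw [mul_left_comm, ← exp_add, neg_add_cancel, exp_zero, mul_one]
    _ ≤ |D| * (κ * (2 * 2 ^ a k / 2 ^ a (k + 1))) *
          (2 ^ a (k + 1) * exp ((τ - 1) * (κ * p k))) := by
        gcongr
        exact hle.trans (mul_le_mul (le_abs_self D) herr (abs_nonneg _) (abs_nonneg _))
    _ = _ := by field_simp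

theorem not_hasCornerBound (h : IsDyadicApprox a p β) (hτ : 1 ≤ τ) {ε : ℝ} (hε : 0 < ε)
    (hlarge : ∀ᶠ k in atTop, exp (((τ - 1) * log (3 / 2) + ε) * p k) ≤ 2 ^ a (k + 1)) :
    ¬HasCornerBound τ ((2 / 3) ^ β) := fun hbound => by
  obtain ⟨C, hC⟩ := h.exists_two_pow_le hτ hbound
  obtain ⟨k, hk, hpk⟩ :=
    (hlarge.and (h.tendsto_numerator.eventually_gt_atTop (2 * |C| / ε ^ 2))).exists
  set P : ℝ := (p k : ℝ)
  have hP : 0 < P := (by positivity : (0 : ℝ) < 2 ^ a k).trans_le (h.two_pow_le_cast k)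
  have hexp : exp (ε * P) ≤ |C| * P := by
    refine le_of_mul_le_mul_right ?_ (exp_pos ((τ - 1) * (log (3 / 2) * P)))
    calc exp (ε * P) * exp ((τ - 1) * (log (3 / 2) * P))
        = exp (((τ - 1) * log (3 / 2) + ε) * P) := by rw [← exp_add]; ring_nf
      _ ≤ C * 2 ^ a k * exp ((τ - 1) * (log (3 / 2) * P)) := hk.trans (hC k)
      _ ≤ |C| * P * exp ((τ - 1) * (log (3 / 2) * P)) := by
          gcongr
          · exact le_abs_self C
          · exact h.two_pow_le_cast k
  have hquad := quadratic_le_exp_of_nonneg (mul_pos hε hP).le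
  rw [div_lt_iff₀ (by positivity)] at hpk
  nlinarith [mul_pos hε hP]

end IsDyadicApprox

theorem two_rpow_ceil_mem_Icc (x : ℝ) (hx : 0 ≤ x) :
    (2 : ℝ) ^ ⌈x / log 2⌉₊ ∈ Set.Icc (exp x) (2 * exp x) := by
  have hlog : 0 < log 2 := log_pos one_lt_two
  have hexp : ∀ y : ℝ, exp (log 2 * y) = 2 ^ y := fun y => (rpow_def_of_pos two_pos y).symm
  have hx' : exp x = 2 ^ (x / log 2) := by rw [← hexp, mul_div_cancel₀ _ hlog.ne']
  rw [hx', ← rpow_natCast]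
  refine ⟨rpow_le_rpow_of_exponent_le one_le_two (Nat.le_ceil _), ?_⟩
  rw [mul_comm, ← rpow_add_one two_ne_zero]
  exact rpow_le_rpow_of_exponent_le one_le_two (Nat.ceil_lt_add_one (by positivity)).le

theorem sq_le_exp {ε x : ℝ} (hε : 0 < ε) (hx : 0 ≤ x) : x ^ 2 ≤ 2 / ε ^ 2 * exp (ε * x) := by
  rw [div_mul_eq_mul_div, le_div_iff₀ (by positivity)]
  nlinarith [quadratic_le_exp_of_nonneg (mul_nonneg hε.le hx), mul_nonneg hε.le hx]

theorem exists_ratio_forall_not_hasCornerBound :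
    ∃ r, IsAdmissibleRatio r ∧ ∀ τ, 1 ≤ τ → ¬HasCornerBound τ r := by
  obtain ⟨a, p, β, h, ha⟩ :=
    exists_isDyadicApprox (F := fun a p => p ^ 2 + (2 * a + 2)) fun _ _ => Nat.le_add_left _ _
  refine ⟨_, h.isAdmissibleRatio, fun τ hτ => h.not_hasCornerBound hτ one_pos ?_⟩
  filter_upwards [h.tendsto_numerator.eventually_ge_atTop
    (((τ - 1) * log (3 / 2) + 1) / log 2)] with k hk
  rw [div_le_iff₀ (log_pos one_lt_two)] at hk
  calc exp (((τ - 1) * log (3 / 2) + 1) * p k) ≤ exp (p k * log 2 * p k) := by gcongr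
    _ = 2 ^ p k ^ 2 := by
        rw [← rpow_natCast, rpow_def_of_pos two_pos]
        push_cast
        ring_nf
    _ ≤ 2 ^ a (k + 1) := pow_le_pow_right₀ one_le_two (ha k ▸ Nat.le_add_right _ _)

theorem exists_ratio_hasCornerBound_forall_lt {τ₀ : ℝ} (hτ₀ : 1 < τ₀) :
    ∃ r, IsAdmissibleRatio r ∧ HasCornerBound τ₀ r ∧
      ∀ τ, 1 ≤ τ → τ < τ₀ → ¬HasCornerBound τ r := by
  set κ := log (3 / 2)
  have hκ : 0 < κ := log_three_halves_pos
  have hε : 0 < (τ₀ - 1) * κ := mul_pos (sub_pos.2 hτ₀) hκ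
  obtain ⟨a, p, β, h, ha⟩ := exists_isDyadicApprox
    (F := fun a p => max (2 * a + 2) ⌈(τ₀ - 1) * κ * p / log 2⌉₊) fun _ _ => le_max_left _ _
  have hceil k := two_rpow_ceil_mem_Icc ((τ₀ - 1) * κ * p k) (by positivity)
  refine ⟨_, h.isAdmissibleRatio, h.hasCornerBound hτ₀.le
    (C := max (2 / ((τ₀ - 1) * κ) ^ 2) 2) fun k => ?_, fun τ hτ hlt =>
    h.not_hasCornerBound hτ (mul_pos (sub_pos.2 hlt) hκ) (.of_forall fun k => ?_)⟩
  · rw [ha, ← mul_assoc]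
    rcases max_cases (2 * a k + 2) ⌈(τ₀ - 1) * κ * p k / log 2⌉₊ with ⟨heq, -⟩ | ⟨heq, -⟩
    · rw [heq]
      calc (2 : ℝ) ^ (2 * a k + 2) ≤ 2 / ((τ₀ - 1) * κ) ^ 2 * exp ((τ₀ - 1) * κ * p k) :=
            (h.two_pow_le_sq k).trans (sq_le_exp hε (Nat.cast_nonneg _))
        _ ≤ _ := by gcongr; exact le_max_left _ _
    · rw [heq]
      exact (hceil k).2.trans (by gcongr; exact le_max_right _ _)
  · calc exp (((τ - 1) * κ + (τ₀ - τ) * κ) * p k) = exp ((τ₀ - 1) * κ * p k) := by ring_nf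
      _ ≤ 2 ^ ⌈(τ₀ - 1) * κ * p k / log 2⌉₊ := (hceil k).1
      _ ≤ 2 ^ a (k + 1) := pow_le_pow_right₀ one_le_two (ha k ▸ le_max_right _ _)

theorem exists_ratio_not_hasCornerBound_forall_gt {τ₀ : ℝ} (hτ₀ : 1 ≤ τ₀) :
    ∃ r, IsAdmissibleRatio r ∧ (∀ τ, τ₀ < τ → HasCornerBound τ r) ∧ ¬HasCornerBound τ₀ r := by
  set κ := log (3 / 2)
  have hκ : 0 < κ := log_three_halves_pos
  obtain ⟨a, p, β, h, ha⟩ := exists_isDyadicApprox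
    (F := fun a p => ⌈(τ₀ - 1) * κ * p / log 2⌉₊ + (2 * a + 2)) fun _ _ => Nat.le_add_left _ _
  have hceil k := two_rpow_ceil_mem_Icc ((τ₀ - 1) * κ * p k) (by positivity)
  refine ⟨_, h.isAdmissibleRatio, fun τ hlt => h.hasCornerBound (hτ₀.trans hlt.le)
    (C := 2 * (2 / ((τ - τ₀) * κ) ^ 2)) fun k => ?_, fun hbound => ?_⟩
  · have hε : 0 < (τ - τ₀) * κ := mul_pos (sub_pos.2 hlt) hκ
    calc (2 : ℝ) ^ a (k + 1)
        = 2 ^ ⌈(τ₀ - 1) * κ * p k / log 2⌉₊ * 2 ^ (2 * a k + 2) := by rw [ha, pow_add]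
      _ ≤ 2 * exp ((τ₀ - 1) * κ * p k) *
            (2 / ((τ - τ₀) * κ) ^ 2 * exp ((τ - τ₀) * κ * p k)) := by
          gcongr
          · exact (hceil k).2
          · exact (h.two_pow_le_sq k).trans (sq_le_exp hε (Nat.cast_nonneg _))
      _ = 2 * (2 / ((τ - τ₀) * κ) ^ 2) *
            (exp ((τ₀ - 1) * κ * p k) * exp ((τ - τ₀) * κ * p k)) := by ring
      _ = 2 * (2 / ((τ - τ₀) * κ) ^ 2) * exp ((τ - 1) * (κ * p k)) := by
          rw [← exp_add]
          ring_nf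
  · obtain ⟨C, hC⟩ := h.exists_two_pow_le hτ₀ hbound
    obtain ⟨k, hk⟩ := pow_unbounded_of_one_lt C (one_lt_two : (1 : ℝ) < 2)
    have hle : exp ((τ₀ - 1) * (κ * p k)) * 2 ^ (2 * a k + 2) ≤
        C * 2 ^ a k * exp ((τ₀ - 1) * (κ * p k)) := by
      refine le_trans ?_ (hC k)
      rw [ha, pow_add 2 ⌈_⌉₊, ← mul_assoc (τ₀ - 1)]
      gcongr
      exact (hceil k).1
    have hCle : C ≤ 2 ^ a k := hk.le.trans (pow_le_pow_right₀ one_le_two (h.le_index k))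
    have hpow : (2 : ℝ) ^ (2 * a k + 2) = 4 * (2 ^ a k * 2 ^ a k) := by ring
    rw [hpow, mul_comm, mul_le_mul_iff_left₀ (exp_pos _)] at hle
    nlinarith [pow_pos (two_pos : (0 : ℝ) < 2) (a k)]

end CornerBound

section Polygons

open Set Filter Topology

/-! ### Convex hulls touching at a point -/

section Separation

variable {E : Type*} [NormedAddCommGroup E] [NormedSpace ℝ E] {s t : Set E} {p : E}

theorem eventually_mul_norm_sub_le (g : E →L[ℝ] ℝ) (hs : s.Finite)
    (h : ∀ v ∈ s, v = p ∨ 0 < g (v - p)) :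
    ∀ᶠ κ : ℝ in 𝓝[>] 0, ∀ x ∈ convexHull ℝ s, κ * ‖x - p‖ ≤ g (x - p) := by
  have hvertex : ∀ᶠ κ : ℝ in 𝓝[>] 0, ∀ v ∈ s, κ * ‖v - p‖ ≤ g (v - p) := by
    refine (eventually_all_finite hs).2 fun v hv => ?_
    rcases h v hv with rfl | hpos
    · simp only [sub_self, norm_zero, mul_zero, map_zero, le_refl, eventually_true]
    · have hlim : Tendsto (fun κ : ℝ => κ * ‖v - p‖) (𝓝[>] 0) (𝓝 (0 * ‖v - p‖)) :=
        (tendsto_id.mono_left nhdsWithin_le_nhds).mul_const _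
      rw [zero_mul] at hlim
      exact hlim.eventually_le_const hpos
  filter_upwards [hvertex, self_mem_nhdsWithin] with κ hκ hpos
  have hconv : ConvexOn ℝ Set.univ fun x => κ * ‖x - p‖ - g (x - p) := by
    have hnorm : ConvexOn ℝ Set.univ fun x => ‖x - p‖ := by
      simpa only [dist_eq_norm] using convexOn_univ_dist p
    refine (hnorm.smul (le_of_lt hpos)).sub ⟨convex_univ, fun x _ y _ a b _ _ hab => le_of_eq ?_⟩
    have hp : g p = a * g p + b * g p := by rw [← add_mul, hab, one_mul]
    simp only [map_sub, map_add, map_smul, smul_eq_mul]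
    linear_combination hp
  have hsub : convexHull ℝ s ⊆ {x ∈ Set.univ | κ * ‖x - p‖ - g (x - p) ≤ 0} :=
    convexHull_min (fun v hv => ⟨Set.mem_univ v, sub_nonpos.2 (hκ v hv)⟩) (hconv.convex_le 0)
  exact fun x hx => sub_nonpos.1 (hsub hx).2

theorem exists_dist_add_dist_le_of_separated (g : E →L[ℝ] ℝ) (hs : s.Finite) (ht : t.Finite)
    (hsp : ∀ v ∈ s, v = p ∨ g (v - p) < 0) (htp : ∀ v ∈ t, v = p ∨ 0 < g (v - p)) :
    ∃ C, ∀ x ∈ convexHull ℝ s, ∀ y ∈ convexHull ℝ t,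
      dist x p + dist p y ≤ C * dist x y := by
  obtain ⟨κ, ⟨hκs, hκt⟩, hκ : 0 < κ⟩ :=
    (((eventually_mul_norm_sub_le (-g) hs fun v hv => (hsp v hv).imp_right neg_pos.2).and
      (eventually_mul_norm_sub_le g ht htp)).and self_mem_nhdsWithin).exists
  refine ⟨‖g‖ / κ, fun x hx y hy => ?_⟩
  rw [div_mul_eq_mul_div, le_div_iff₀' hκ, dist_comm p, dist_comm x y]
  simp only [dist_eq_norm]
  calc κ * (‖x - p‖ + ‖y - p‖) = κ * ‖x - p‖ + κ * ‖y - p‖ := mul_add _ _ _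
    _ ≤ -g (x - p) + g (y - p) := add_le_add (hκs x hx) (hκt y hy)
    _ = g (y - x) := by simp only [map_sub]; ring
    _ ≤ ‖g‖ * ‖y - x‖ := (le_abs_self _).trans (g.le_opNorm _)

/-- Two cones on either side of the line `ker g`, both touching it along the ray of `e`. -/
theorem abs_sub_mul_norm_le (g : E →L[ℝ] ℝ) {a b e : E} {κ ρ σ : ℝ} (hκ : 0 < κ) (he : g e = 0)
    (ha : κ * ‖a‖ ≤ -g a) (hb : κ * ‖b‖ ≤ g b) (hρ : 0 ≤ ρ) (hσ : 0 ≤ σ) :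
    |ρ - σ| * ‖e‖ ≤ (1 + ‖g‖ / κ) * dist (ρ • (e + a)) (σ • (e + b)) := by
  set d := ρ • (e + a) - σ • (e + b)
  have hg : κ * (ρ * ‖a‖ + σ * ‖b‖) ≤ ‖g‖ * ‖d‖ :=
    calc κ * (ρ * ‖a‖ + σ * ‖b‖) = ρ * (κ * ‖a‖) + σ * (κ * ‖b‖) := by ring
      _ ≤ ρ * -g a + σ * g b := by gcongr
      _ = -g d := by
        simp only [d, map_sub, map_smul, map_add, he, smul_eq_mul]
        ring
      _ ≤ ‖g‖ * ‖d‖ := (neg_le_abs _).trans (g.le_opNorm _)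
  have hoff : ‖ρ • a - σ • b‖ ≤ ‖g‖ * ‖d‖ / κ := by
    rw [le_div_iff₀' hκ]
    refine (mul_le_mul_of_nonneg_left ((norm_sub_le _ _).trans_eq ?_) hκ.le).trans hg
    rw [norm_smul, norm_smul, Real.norm_of_nonneg hρ, Real.norm_of_nonneg hσ]
  calc |ρ - σ| * ‖e‖ = ‖d - (ρ • a - σ • b)‖ := by
        rw [← Real.norm_eq_abs, ← norm_smul]
        congr 1
        simp only [d]
        module
    _ ≤ ‖d‖ + ‖g‖ * ‖d‖ / κ := (norm_sub_le _ _).trans (add_le_add_right hoff _)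
    _ = (1 + ‖g‖ / κ) * dist (ρ • (e + a)) (σ • (e + b)) := by rw [dist_eq_norm]; ring

end Separation

section ArgPos

theorem argPos_nonneg (z : ℂ) : 0 ≤ argPos z := left_le_toIcoMod _ _ _

theorem argPos_ofReal {x : ℝ} (hx : 0 ≤ x) : argPos x = 0 := by
  rw [argPos, Complex.arg_ofReal_of_nonneg hx]
  exact toIcoMod_apply_left _ _

theorem argPos_pos {z : ℂ} (hz : z.im ≠ 0) : 0 < argPos z := by
  refine (argPos_nonneg z).lt_of_ne fun h0 => hz ?_
  have hnonneg : 0 ≤ z.arg := by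
    by_contra! hneg
    have heq : argPos z = z.arg + 2 * Real.pi := by
      rw [argPos, ← toIcoMod_add_right, toIcoMod_eq_self]
      exact ⟨by linarith [Complex.neg_pi_lt_arg z, Real.pi_pos], by linarith⟩
    linarith [Complex.neg_pi_lt_arg z, Real.pi_pos]
  have heq : argPos z = z.arg :=
    (toIcoMod_eq_self _).2 ⟨hnonneg, by linarith [Complex.arg_le_pi z, Real.pi_pos]⟩
  exact (Complex.arg_eq_zero_iff.1 (heq ▸ h0.symm)).2

end ArgPos

namespace Polygon

variable (P : Polygon)

/-- The complex ratio of the similitude `P.S j`. -/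
noncomputable def ratio (j : ℕ) : ℂ := (P.A j - P.A (j - 1)) / (P.A P.ℓ - P.A 0)

theorem S_sub (j : ℕ) (z w : ℂ) : P.S j z - P.S j w = P.ratio j * (z - w) := by
  rw [S, S, ratio]
  ring

theorem dist_S (j : ℕ) (z w : ℂ) : dist (P.S j z) (P.S j w) = ‖P.ratio j‖ * dist z w := by
  rw [dist_eq_norm, S_sub, norm_mul, dist_eq_norm]

theorem S_first (j : ℕ) : P.S j (P.A 0) = P.A (j - 1) := by
  rw [S, sub_self, mul_zero, add_zero]

theorem image_S_convexHull (j : ℕ) (s : Set ℂ) :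
    P.S j '' convexHull ℝ s = convexHull ℝ (P.S j '' s) := by
  let f : ℂ →ᵃ[ℝ] ℂ := (LinearMap.mulLeft ℝ (P.ratio j)).toAffineMap +
    AffineMap.const ℝ ℂ (P.A (j - 1) - P.ratio j * P.A 0)
  have hf : P.S j = f := funext fun z => by
    rw [S]
    change _ = P.ratio j * z + (P.A (j - 1) - P.ratio j * P.A 0)
    rw [ratio]
    ring
  rw [hf, f.image_convexHull]

variable {P}

theorem S_last (h : P.A P.ℓ ≠ P.A 0) (j : ℕ) : P.S j (P.A P.ℓ) = P.A j := by
  rw [S, div_mul_cancel₀ _ (sub_ne_zero.2 h), add_sub_cancel]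

theorem S_injective (hA : Set.InjOn P.A (Set.Iic P.ℓ)) {j : ℕ} (hj : j ∈ Set.Icc 1 P.ℓ) :
    Function.Injective (P.S j) := by
  have hne : ∀ {i k}, i < k → k ≤ P.ℓ → P.A k - P.A i ≠ 0 := fun hik hk h0 =>
    hik.ne' (hA hk (hik.le.trans hk) (sub_eq_zero.1 h0))
  have hratio : P.ratio j ≠ 0 := div_ne_zero (hne (Nat.sub_one_lt_of_lt hj.1) hj.2)
    (hne (hj.1.trans hj.2) le_rfl)
  intro z w h
  rw [← sub_eq_zero, S_sub] at h
  exact sub_eq_zero.1 ((mul_eq_zero.1 h).resolve_left hratio)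

end Polygon

/-! ### The basic triangle -/

section FlatTriangle

/-- The real-linear functional `x + i y ↦ a x + b y` on the plane. -/
noncomputable def linearForm (a b : ℝ) : ℂ →L[ℝ] ℝ := a • Complex.reCLM + b • Complex.imCLM

theorem linearForm_apply (a b : ℝ) (z : ℂ) : linearForm a b z = a * z.re + b * z.im := rfl

theorem interior_preimage_linearForm {a b : ℝ} (h : a ≠ 0 ∨ b ≠ 0) (s : Set ℝ) :
    interior (linearForm a b ⁻¹' s) = linearForm a b ⁻¹' interior s := by
  refine (IsOpenMap.preimage_interior_eq_interior_preimage
    ((linearForm a b).isOpenMap_of_ne_zero ?_) (linearForm a b).continuous s).symm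
  intro h0
  have ha : a = 0 := by simpa [linearForm_apply] using congr($h0 1)
  have hb : b = 0 := by simpa [linearForm_apply] using congr($h0 Complex.I)
  exact h.elim (· ha) (· hb)

/-- The apex of the basic triangle. -/
noncomputable def apex : ℂ := ⟨1 / 2, 1 / 4⟩

/-- The closed triangle with corners `0`, `1` and `apex`. -/
def flatTriangle : Set ℂ := {z | 0 ≤ z.im ∧ 2 * z.im ≤ z.re ∧ 2 * z.im ≤ 1 - z.re}

theorem flatTriangle_eq_inter_preimage : flatTriangle =
    linearForm 0 1 ⁻¹' Ici 0 ∩ (linearForm 1 (-2) ⁻¹' Ici 0 ∩ linearForm 1 2 ⁻¹' Iic 1) := by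
  ext z
  simp only [flatTriangle, mem_ofPred_eq, mem_inter_iff, mem_preimage, mem_Ici, mem_Iic,
    linearForm_apply]
  constructor <;> rintro ⟨him, hleft, hright⟩ <;> exact ⟨by linarith, by linarith, by linarith⟩

theorem isClosed_flatTriangle : IsClosed flatTriangle := by
  rw [flatTriangle_eq_inter_preimage]
  exact (isClosed_Ici.preimage (linearForm _ _).continuous).inter
    ((isClosed_Ici.preimage (linearForm _ _).continuous).inter
      (isClosed_Iic.preimage (linearForm _ _).continuous))

theorem convex_flatTriangle : Convex ℝ flatTriangle := by
  rw [flatTriangle_eq_inter_preimage]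
  exact ((convex_Ici _).linear_preimage (linearForm _ _).toLinearMap).inter
    (((convex_Ici _).linear_preimage (linearForm _ _).toLinearMap).inter
      ((convex_Iic _).linear_preimage (linearForm _ _).toLinearMap))

theorem interior_flatTriangle :
    interior flatTriangle = {z | 0 < z.im ∧ 2 * z.im < z.re ∧ 2 * z.im < 1 - z.re} := by
  rw [flatTriangle_eq_inter_preimage, interior_inter, interior_inter,
    interior_preimage_linearForm (.inr one_ne_zero), interior_preimage_linearForm
    (.inl one_ne_zero), interior_preimage_linearForm (.inl one_ne_zero), interior_Ici, interior_Iic]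
  ext z
  simp only [mem_ofPred_eq, mem_inter_iff, mem_preimage, mem_Ioi, mem_Iio, linearForm_apply]
  constructor <;> rintro ⟨him, hleft, hright⟩ <;> exact ⟨by linarith, by linarith, by linarith⟩

theorem closure_interior_flatTriangle : closure (interior flatTriangle) = flatTriangle := by
  rw [convex_flatTriangle.closure_interior_eq_closure_of_nonempty_interior,
    isClosed_flatTriangle.closure_eq]
  rw [interior_flatTriangle]
  exact ⟨⟨1 / 2, 1 / 8⟩, by norm_num, by norm_num, by norm_num⟩

theorem zero_mem_flatTriangle : 0 ∈ flatTriangle := by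
  refine ⟨?_, ?_, ?_⟩ <;> norm_num

theorem one_mem_flatTriangle : 1 ∈ flatTriangle := by
  refine ⟨?_, ?_, ?_⟩ <;> norm_num

theorem apex_mem_flatTriangle : apex ∈ flatTriangle := by
  refine ⟨?_, ?_, ?_⟩ <;> norm_num [apex]

theorem convexHull_eq_flatTriangle : convexHull ℝ {0, 1, apex} = flatTriangle := by
  refine (convexHull_min ?_ convex_flatTriangle).antisymm fun z ⟨him, hleft, hright⟩ => ?_
  · rintro z (rfl | rfl | rfl)
    exacts [zero_mem_flatTriangle, one_mem_flatTriangle, apex_mem_flatTriangle]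
  refine mem_convexHull_of_exists_fintype ![1 - z.re - 2 * z.im, z.re - 2 * z.im, 4 * z.im]
    ![0, 1, apex] ?_ ?_ ?_ ?_
  · exact Fin.forall_fin_succ.2 ⟨by change 0 ≤ 1 - z.re - 2 * z.im; linarith,
      Fin.forall_fin_two.2 ⟨sub_nonneg.2 hleft, mul_nonneg zero_le_four him⟩⟩
  · simp only [Fin.sum_univ_three, Matrix.cons_val]
    ring
  · simp [Fin.forall_fin_succ]
  · rw [Fin.sum_univ_three]
    apply Complex.ext <;> simp [apex] <;> ring

theorem dist_le_two_of_mem_flatTriangle {z w : ℂ} (hz : z ∈ flatTriangle)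
    (hw : w ∈ flatTriangle) : dist z w ≤ 2 := by
  obtain ⟨hz1, hz2, hz3⟩ := hz
  obtain ⟨hw1, hw2, hw3⟩ := hw
  have hre : |z.re - w.re| ≤ 1 := abs_le.2 ⟨by linarith, by linarith⟩
  have him : |z.im - w.im| ≤ 1 := abs_le.2 ⟨by linarith, by linarith⟩
  calc dist z w ≤ |z.re - w.re| + |z.im - w.im| := by
        rw [dist_eq_norm, ← Complex.sub_re, ← Complex.sub_im]
        exact Complex.norm_le_abs_re_add_abs_im _
    _ ≤ 2 := by linarith

end FlatTriangle

theorem rpow_le_mul_of_le {x B K D τ : ℝ} (hx : 0 ≤ x) (hxB : x ≤ B) (hτ : 1 ≤ τ)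
    (h : x ≤ K * D) : x ^ τ ≤ B ^ (τ - 1) * K * D := by
  have hB : 0 ≤ B ^ (τ - 1) := Real.rpow_nonneg (hx.trans hxB) _
  rw [mul_assoc]
  calc x ^ τ = x ^ (τ - 1) * x := by
        rw [← Real.rpow_add_one' hx (by linarith), sub_add_cancel]
    _ ≤ B ^ (τ - 1) * (K * D) := by
        have := sub_nonneg.2 hτ
        gcongr

theorem IsAdmissibleRatio.mem_Ioo {r : ℝ} (hr : IsAdmissibleRatio r) : r ∈ Ioo (1 / 3) (4 / 9) :=
  ⟨hr.one_third_lt, hr.lt_four_ninths⟩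

theorem im_div_ne_zero {z w : ℂ} (h : z.im * w.re - z.re * w.im ≠ 0) : (z / w).im ≠ 0 := by
  have hw : w ≠ 0 := by
    rintro rfl
    simp at h
  rw [Complex.div_im, ← sub_div]
  exact div_ne_zero h (Complex.normSq_pos.2 hw).ne'

theorem ofReal_mem_segment {a b x : ℝ} (hx : x ∈ Icc a b) :
    (x : ℂ) ∈ segment ℝ (a : ℂ) (b : ℂ) := by
  have himage := image_segment ℝ Complex.ofRealCLM.toLinearMap.toAffineMap a b
  rw [segment_eq_Icc (hx.1.trans hx.2)] at himage
  exact himage ▸ mem_image_of_mem _ hx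

/-! ### The polygons -/

/-- The vertex `4 / 9 + (4 / 9) * (2 / 3) ^ 5 * ω`, where `ω = (-3 + 4 * i) / 5` rotates the
direction of `apex` to the direction of `apex - 1`, is chosen so that the triangles of the first
two pieces have a side in common at the vertex `4 / 9`. Along this side the pieces accumulate at
`4 / 9` with the ratios `r` and `4 / 9`. -/
noncomputable def cornerPolygon (r : ℝ) : Polygon where
  ℓ := 5
  A
    | 0 => 0
    | 1 => (4 / 9 : ℝ)
    | 2 => ⟨1492 / 3645, 512 / 10935⟩
    | 3 => apex
    | 4 => (1 - r : ℝ)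
    | _ => 1
  q := 3

namespace cornerPolygon

variable (r : ℝ)

theorem A_zero : (cornerPolygon r).A 0 = 0 := rfl
theorem A_one : (cornerPolygon r).A 1 = (4 / 9 : ℝ) := rfl
theorem A_two : (cornerPolygon r).A 2 = ⟨1492 / 3645, 512 / 10935⟩ := rfl
theorem A_three : (cornerPolygon r).A 3 = apex := rfl
theorem A_four : (cornerPolygon r).A 4 = (1 - r : ℝ) := rfl
theorem A_five : (cornerPolygon r).A 5 = 1 := rfl
theorem ℓ_eq : (cornerPolygon r).ℓ = 5 := rfl
theorem q_eq : (cornerPolygon r).q = 3 := rfl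

theorem ratio_eq (j : ℕ) :
    (cornerPolygon r).ratio j = (cornerPolygon r).A j - (cornerPolygon r).A (j - 1) := by
  rw [Polygon.ratio, ℓ_eq, A_five, A_zero, sub_zero, div_one]

theorem S_eq (j : ℕ) (z : ℂ) : (cornerPolygon r).S j z = (cornerPolygon r).A (j - 1) +
    ((cornerPolygon r).A j - (cornerPolygon r).A (j - 1)) * z := by
  rw [Polygon.S, ℓ_eq, A_five, A_zero, sub_zero, sub_zero, div_one]

theorem S_one (z : ℂ) : (cornerPolygon r).S 1 z = ⟨4 / 9 * z.re, 4 / 9 * z.im⟩ := by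
  rw [S_eq]
  apply Complex.ext <;> simp [A_zero, A_one]

theorem S_two (z : ℂ) : (cornerPolygon r).S 2 z =
    ⟨4 / 9 - 128 / 3645 * z.re - 512 / 10935 * z.im, 512 / 10935 * z.re - 128 / 3645 * z.im⟩ := by
  rw [S_eq]
  apply Complex.ext <;> simp [A_one, A_two] <;> ring

theorem S_three (z : ℂ) : (cornerPolygon r).S 3 z =
    ⟨1492 / 3645 + 661 / 7290 * z.re - 8887 / 43740 * z.im,
      512 / 10935 + 8887 / 43740 * z.re + 661 / 7290 * z.im⟩ := by
  rw [S_eq]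
  apply Complex.ext <;> simp [A_two, A_three, apex] <;> ring

theorem S_four (z : ℂ) : (cornerPolygon r).S 4 z =
    ⟨1 / 2 + (1 / 2 - r) * z.re + 1 / 4 * z.im, 1 / 4 - 1 / 4 * z.re + (1 / 2 - r) * z.im⟩ := by
  rw [S_eq]
  apply Complex.ext <;> simp [A_three, A_four, apex] <;> ring

theorem S_five (z : ℂ) : (cornerPolygon r).S 5 z = ⟨1 - r + r * z.re, r * z.im⟩ := by
  rw [S_eq]
  apply Complex.ext <;> simp [A_four, A_five]

theorem triangle_eq : (cornerPolygon r).triangle = flatTriangle := by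
  rw [← closure_interior_flatTriangle, ← convexHull_eq_flatTriangle]
  rfl

theorem openTriangle_eq : (cornerPolygon r).openTriangle =
    {z | 0 < z.im ∧ 2 * z.im < z.re ∧ 2 * z.im < 1 - z.re} := by
  rw [← interior_flatTriangle, ← convexHull_eq_flatTriangle]
  rfl

theorem theta_one : (cornerPolygon r).theta 1 = 0 := by
  have hside : (cornerPolygon r).S 1 apex - (4 / 9 : ℝ) =
      (243 / 32 : ℝ) * ((cornerPolygon r).S 2 apex - (4 / 9 : ℝ)) := by
    rw [S_one, S_two]
    apply Complex.ext <;> norm_num [apex]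
  have hne : (cornerPolygon r).S 2 apex - (4 / 9 : ℝ) ≠ 0 := by
    intro h0
    have him := congrArg Complex.im h0
    norm_num [S_two, apex] at him
  rw [Polygon.theta, q_eq, A_one, A_three, hside, mul_div_cancel_right₀ _ hne]
  exact argPos_ofReal (by norm_num)

theorem thetaMin_eq_zero : (cornerPolygon r).thetaMin = 0 := by
  have hnonneg : ∀ θ ∈ (cornerPolygon r).theta '' Icc 1 ((cornerPolygon r).ℓ - 1), 0 ≤ θ :=
    forall_mem_image.2 fun _ _ => argPos_nonneg _
  have hone : 1 ∈ Icc 1 ((cornerPolygon r).ℓ - 1) := by norm_num [ℓ_eq]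
  exact (csInf_le ⟨0, hnonneg⟩ ⟨1, hone, theta_one r⟩).antisymm (Real.sInf_nonneg hnonneg)

variable {r}

theorem injOn_A (hr : r ∈ Ioo (1 / 3) (4 / 9)) :
    InjOn (cornerPolygon r).A (Iic (cornerPolygon r).ℓ) := by
  have hne : ∀ i j, i < j → j ≤ 5 → ((cornerPolygon r).A i).re ≠ ((cornerPolygon r).A j).re := by
    obtain ⟨hr1, hr2⟩ := hr
    intro i j hij hj
    interval_cases j <;> interval_cases i <;>
      simp only [A_zero, A_one, A_two, A_three, A_four, A_five, apex, Complex.ofReal_re,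
        Complex.zero_re, Complex.one_re] <;> intro h <;> linarith
  intro i hi j hj h
  rcases lt_trichotomy i j with hij | hij | hij
  · exact absurd (congrArg Complex.re h) (hne i j hij hj)
  · exact hij
  · exact absurd (congrArg Complex.re h).symm (hne j i hij hi)

theorem norm_ratio_le (hr : r ∈ Ioo (1 / 3) (4 / 9)) {j : ℕ} (hj : j ∈ Icc 1 5) :
    ‖(cornerPolygon r).ratio j‖ ≤ 4 / 9 := by
  obtain ⟨hr1, hr2⟩ := hr
  obtain ⟨hj1, hj5⟩ := hj
  rw [ratio_eq]
  refine (Complex.norm_le_abs_re_add_abs_im _).trans ?_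
  interval_cases j <;> simp only [Nat.sub_self, Nat.reduceSub, A_zero, A_one, A_two, A_three,
    A_four, A_five, apex, Complex.sub_re, Complex.sub_im, Complex.ofReal_re, Complex.ofReal_im,
    Complex.zero_re, Complex.zero_im, Complex.one_re, Complex.one_im]
  · norm_num
  · norm_num
  · norm_num
  · rw [abs_of_pos (by linarith)]
    norm_num
    linarith
  · rw [abs_of_pos (by linarith)]
    norm_num
    linarith

theorem mapsTo_S (hr : r ∈ Ioo (1 / 3) (4 / 9)) {j : ℕ} (hj : j ∈ Icc 1 5) :
    MapsTo ((cornerPolygon r).S j) flatTriangle flatTriangle := by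
  rw [mapsTo_iff_image_subset, ← convexHull_eq_flatTriangle, Polygon.image_S_convexHull,
    convexHull_eq_flatTriangle]
  refine convexHull_min ?_ convex_flatTriangle
  obtain ⟨hr1, hr2⟩ := hr
  obtain ⟨hj1, hj5⟩ := hj
  rintro _ ⟨z, rfl | rfl | rfl, rfl⟩ <;> interval_cases j <;>
    simp only [S_one, S_two, S_three, S_four, S_five, flatTriangle, apex, mem_ofPred_eq,
      Complex.zero_re, Complex.zero_im, Complex.one_re, Complex.one_im] <;>
    refine ⟨?_, ?_, ?_⟩ <;> linarith

theorem S_ne_S (hr : r ∈ Ioo (1 / 3) (4 / 9)) {i j : ℕ} (hi : 1 ≤ i) (hij : i + 1 < j)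
    (hj : j ≤ 5) {z w : ℂ} (hz : z ∈ flatTriangle) (hw : w ∈ flatTriangle) :
    (cornerPolygon r).S i z ≠ (cornerPolygon r).S j w := by
  obtain ⟨hr1, hr2⟩ := hr
  obtain ⟨hz1, hz2, hz3⟩ := hz
  obtain ⟨hw1, hw2, -⟩ := hw
  have hfour : 0 ≤ (1 / 2 - r) * w.re := mul_nonneg (by linarith) (by linarith)
  have hfive : 0 ≤ r * w.re := mul_nonneg (by linarith) (by linarith)
  intro h
  have hre := congrArg Complex.re h
  have him := congrArg Complex.im h
  have hi3 : i ≤ 3 := by omega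
  interval_cases i <;> interval_cases j <;>
    simp only [S_one, S_two, S_three, S_four, S_five] at hre him <;> linarith

theorem disjoint_openTriangle (hr : r ∈ Ioo (1 / 3) (4 / 9)) {i j : ℕ} (hi : 1 ≤ i)
    (hij : i < j) (hj : j ≤ 5) :
    Disjoint ((cornerPolygon r).S i '' (cornerPolygon r).openTriangle)
      ((cornerPolygon r).S j '' (cornerPolygon r).openTriangle) := by
  rw [disjoint_left, openTriangle_eq]
  rintro _ ⟨z, ⟨hz1, hz2, hz3⟩, rfl⟩ ⟨w, ⟨hw1, hw2, hw3⟩, h⟩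
  obtain hij' | rfl : i + 1 < j ∨ j = i + 1 := by omega
  · exact S_ne_S hr hi hij' hj ⟨hz1.le, hz2.le, hz3.le⟩ ⟨hw1.le, hw2.le, hw3.le⟩ h.symm
  obtain ⟨hr1, hr2⟩ := hr
  have hpos₁ : 0 < (1 / 2 - r) * w.re := mul_pos (by linarith) (by linarith)
  have hpos₂ : 0 < (1 / 2 - r) * z.im := mul_pos (by linarith) (by linarith)
  have hpos₃ : 0 < r * (w.re - 2 * w.im) := mul_pos (by linarith) (by linarith)
  have hpos₄ : 0 < r * w.im := mul_pos (by linarith) hw1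
  have hpos₅ : 0 < (1 / 2 - r) * (1 - z.re - 2 * z.im) := mul_pos (by linarith) (by linarith)
  have hre := congrArg Complex.re h
  have him := congrArg Complex.im h
  have hi4 : i ≤ 4 := by omega
  interval_cases i <;> norm_num only at hre him <;>
    simp only [S_one, S_two, S_three, S_four, S_five] at hre him <;> linarith

theorem A_one_mem_segment :
    (cornerPolygon r).A 1 ∈ segment ℝ ((cornerPolygon r).A 0) ((cornerPolygon r).A 5) := by
  rw [A_zero, A_one, A_five, ← Complex.ofReal_zero, ← Complex.ofReal_one]
  exact ofReal_mem_segment (by norm_num)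

theorem A_four_mem_segment (hr : r ∈ Icc 0 1) :
    (cornerPolygon r).A 4 ∈ segment ℝ ((cornerPolygon r).A 0) ((cornerPolygon r).A 5) := by
  rw [A_zero, A_four, A_five, ← Complex.ofReal_zero, ← Complex.ofReal_one]
  exact ofReal_mem_segment ⟨sub_nonneg.2 hr.2, sub_le_self _ hr.1⟩

theorem A_four_mem_segment_A_one (hr : r ∈ Icc 0 (5 / 9)) :
    (cornerPolygon r).A 4 ∈ segment ℝ ((cornerPolygon r).A 1) ((cornerPolygon r).A 5) := by
  rw [A_one, A_four, A_five, ← Complex.ofReal_one]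
  exact ofReal_mem_segment ⟨by linarith [hr.2], sub_le_self _ hr.1⟩

theorem disjoint_image_S_two_sides :
    (cornerPolygon r).S 2 '' flatTriangle ∩ (segment ℝ apex 0 ∪ segment ℝ apex 1) = ∅ := by
  rw [eq_empty_iff_forall_notMem]
  rintro _ ⟨⟨z, ⟨hz1, hz2, hz3⟩, rfl⟩, ⟨a, b, -, -, -, h⟩ | ⟨a, b, -, hb, hab, h⟩⟩
  all_goals
    rw [S_two] at h
    have hre := congrArg Complex.re h
    have him := congrArg Complex.im h
    simp only [apex, Complex.add_re, Complex.add_im, Complex.real_smul, Complex.re_ofReal_mul,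
      Complex.im_ofReal_mul, Complex.zero_re, Complex.zero_im, Complex.one_re,
      Complex.one_im] at hre him
    linarith

theorem isBasicFigure (hr : r ∈ Ioo (1 / 3) (4 / 9)) : (cornerPolygon r).IsBasicFigure where
  q_pos := by rw [q_eq]; norm_num
  q_lt := by rw [q_eq, ℓ_eq]; norm_num
  vertices_injOn := injOn_A hr
  first_mem := A_one_mem_segment
  last_mem := A_four_mem_segment ⟨by linarith [hr.1], by linarith [hr.2]⟩
  last_mem' := A_four_mem_segment_A_one ⟨by linarith [hr.1], by linarith [hr.2]⟩
  vertices_mem j hj := by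
    rw [ℓ_eq] at hj
    interval_cases j
    · exact .inl (.inr (left_mem_segment ℝ _ _))
    · exact .inl (.inr A_one_mem_segment)
    · rw [openTriangle_eq, A_two]
      exact .inr ⟨by norm_num, by norm_num, by norm_num⟩
    · exact .inl (.inl rfl)
    · exact .inl (.inr (A_four_mem_segment ⟨by linarith [hr.1], by linarith [hr.2]⟩))
    · exact .inl (.inr (right_mem_segment ℝ _ _))
  contractive j h1 h5 := (norm_ratio_le hr ⟨h1, h5⟩).trans_lt (by norm_num)
  disjoint i j := disjoint_openTriangle hr
  apex_mem j h1 h5 := by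
    rw [triangle_eq]
    exact mapsTo_S hr ⟨h1, h5⟩ apex_mem_flatTriangle
  sides j hj hjl h1 h5 h3 h4 := by
    rw [ℓ_eq] at hjl h5
    rw [q_eq] at h3 h4
    obtain rfl : j = 2 := by omega
    rw [triangle_eq]
    exact disjoint_image_S_two_sides
  orientation := by
    rw [q_eq, ℓ_eq, A_three, A_zero, A_five, sub_zero, sub_zero, div_one]
    norm_num [apex]

theorem characteristicAngle_pos (hr : r ∈ Ioo (1 / 3) (4 / 9)) :
    0 < (cornerPolygon r).characteristicAngle := by
  obtain ⟨hr1, hr2⟩ := hr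
  rw [Polygon.characteristicAngle, thetaMin_eq_zero r, zero_add, lt_min_iff]
  constructor <;> refine argPos_pos (im_div_ne_zero ?_)
  · rw [q_eq, A_three, A_zero, S_three]
    norm_num [apex]
  · rw [q_eq, ℓ_eq, A_three, A_five, S_four]
    intro h
    simp only [apex, Complex.sub_re, Complex.sub_im, Complex.one_re, Complex.one_im] at h
    linarith

/-! ### Distances near the corners -/

theorem S_zero (r : ℝ) (j : ℕ) : (cornerPolygon r).S j 0 = (cornerPolygon r).A (j - 1) :=
  (cornerPolygon r).S_first j

theorem S_apply_one (r : ℝ) (j : ℕ) : (cornerPolygon r).S j 1 = (cornerPolygon r).A j :=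
  Polygon.S_last (one_ne_zero (α := ℂ)) j

theorem S_one_eq_smul (r : ℝ) (z : ℂ) : (cornerPolygon r).S 1 z = (4 / 9 : ℝ) • z := by
  rw [S_one]
  apply Complex.ext <;> simp

theorem S_five_eq_add_smul (r : ℝ) (z : ℂ) : (cornerPolygon r).S 5 z = 1 + r • (z - 1) := by
  rw [S_five]
  apply Complex.ext
  · simp only [Complex.add_re, Complex.one_re, Complex.smul_re, Complex.sub_re, smul_eq_mul]
    ring
  · simp

theorem dist_S_one (r : ℝ) (z w : ℂ) :
    dist ((cornerPolygon r).S 1 z) ((cornerPolygon r).S 1 w) = 4 / 9 * dist z w := by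
  rw [S_one_eq_smul, S_one_eq_smul, dist_smul₀, Real.norm_of_nonneg (by norm_num)]

theorem image_S_flatTriangle (r : ℝ) (j : ℕ) : (cornerPolygon r).S j '' flatTriangle =
    convexHull ℝ {(cornerPolygon r).A (j - 1), (cornerPolygon r).A j,
      (cornerPolygon r).S j apex} := by
  rw [← convexHull_eq_flatTriangle, Polygon.image_S_convexHull, image_insert_eq, image_pair,
    S_zero, S_apply_one]

theorem eventually_mul_norm_S_sub_le (g : ℂ →L[ℝ] ℝ) {p : ℂ} {j : ℕ}
    (h : ∀ v ∈ ({(cornerPolygon r).A (j - 1), (cornerPolygon r).A j,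
      (cornerPolygon r).S j apex} : Set ℂ), v = p ∨ 0 < g (v - p)) :
    ∀ᶠ κ : ℝ in 𝓝[>] 0, ∀ z ∈ flatTriangle,
      κ * ‖(cornerPolygon r).S j z - p‖ ≤ g ((cornerPolygon r).S j z - p) := by
  filter_upwards [eventually_mul_norm_sub_le g (toFinite _) h] with κ hκ z hz
  exact hκ _ (image_S_flatTriangle r j ▸ mem_image_of_mem _ hz)

theorem exists_dist_add_dist_le (hr : r ∈ Ioo (1 / 3) (4 / 9)) {p : ℕ} (hp : p ∈ Icc 2 4) :
    ∃ C, ∀ z ∈ flatTriangle, ∀ w ∈ flatTriangle,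
      dist ((cornerPolygon r).S p z) ((cornerPolygon r).A p) +
        dist ((cornerPolygon r).A p) ((cornerPolygon r).S (p + 1) w) ≤
      C * dist ((cornerPolygon r).S p z) ((cornerPolygon r).S (p + 1) w) := by
  suffices ∃ g : ℂ →L[ℝ] ℝ,
      (∀ v ∈ ({(cornerPolygon r).A (p - 1), (cornerPolygon r).A p,
        (cornerPolygon r).S p apex} : Set ℂ),
        v = (cornerPolygon r).A p ∨ g (v - (cornerPolygon r).A p) < 0) ∧
      ∀ v ∈ ({(cornerPolygon r).A p, (cornerPolygon r).A (p + 1),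
        (cornerPolygon r).S (p + 1) apex} : Set ℂ),
        v = (cornerPolygon r).A p ∨ 0 < g (v - (cornerPolygon r).A p) by
    obtain ⟨g, hleft, hright⟩ := this
    obtain ⟨C, hC⟩ :=
      exists_dist_add_dist_le_of_separated g (toFinite _) (toFinite _) hleft hright
    exact ⟨C, fun z hz w hw => hC _ (image_S_flatTriangle r p ▸ mem_image_of_mem _ hz) _
      (image_S_flatTriangle r (p + 1) ▸ mem_image_of_mem _ hw)⟩
  obtain ⟨hr1, hr2⟩ := hr
  obtain ⟨hp2, hp4⟩ := hp
  simp only [forall_mem_insert, mem_singleton_iff, forall_eq, true_or, true_and]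
  interval_cases p
  · refine ⟨linearForm 0 1, ⟨.inr ?_, .inr ?_⟩, .inr ?_, .inr ?_⟩ <;>
      norm_num [linearForm_apply, A_one, A_two, A_three, S_two, S_three, apex]
  · refine ⟨linearForm 1 0, ⟨.inr ?_, .inr ?_⟩, .inr ?_, .inr ?_⟩ <;>
      norm_num [linearForm_apply, A_two, A_three, A_four, S_three, S_four, apex] <;> linarith
  · refine ⟨linearForm 1 (-1), ⟨.inr ?_, .inr ?_⟩, .inr ?_, .inr ?_⟩ <;>
      norm_num [linearForm_apply, A_three, A_four, A_five, S_four, S_five, apex] <;> linarith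

/-- The lines `x + 2 * y = 1` and `x - 2 * y = 0` are the sides of the basic triangle that the first
two pieces map to their common side. -/
theorem exists_forall_mul_norm_S_sub_apex_le (hr : r ∈ Ioo (1 / 3) (4 / 9)) :
    ∃ κ > 0, (∀ i ∈ Icc 1 4, ∀ z ∈ flatTriangle, κ * ‖(cornerPolygon r).S i z - apex‖ ≤
        linearForm (-1) (-2) ((cornerPolygon r).S i z - apex)) ∧
      ∀ j ∈ Icc 2 5, ∀ z ∈ flatTriangle, κ * ‖(cornerPolygon r).S j z - apex‖ ≤
        linearForm 1 (-2) ((cornerPolygon r).S j z - apex) := by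
  suffices ∀ᶠ κ : ℝ in 𝓝[>] 0,
      (∀ i ∈ Icc 1 4, ∀ z ∈ flatTriangle, κ * ‖(cornerPolygon r).S i z - apex‖ ≤
        linearForm (-1) (-2) ((cornerPolygon r).S i z - apex)) ∧
      ∀ j ∈ Icc 2 5, ∀ z ∈ flatTriangle, κ * ‖(cornerPolygon r).S j z - apex‖ ≤
        linearForm 1 (-2) ((cornerPolygon r).S j z - apex) by
    obtain ⟨κ, h, hκ⟩ := (this.and self_mem_nhdsWithin).exists
    exact ⟨κ, hκ, h⟩
  obtain ⟨hr1, hr2⟩ := hr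
  refine ((eventually_all_finite (toFinite _)).2 ?_).and
    ((eventually_all_finite (toFinite _)).2 ?_) <;>
  · rintro j ⟨hj1, hj2⟩
    refine eventually_mul_norm_S_sub_le _ ?_
    simp only [forall_mem_insert, mem_singleton_iff, forall_eq]
    interval_cases j <;> refine ⟨?_, ?_, ?_⟩ <;> first
      | exact .inl rfl
      | refine .inr ?_
        norm_num [linearForm_apply, A_zero, A_one, A_two, A_three, A_four, A_five, S_one, S_two,
          S_three, S_four, S_five, apex] <;> linarith

theorem norm_apex_sub_one_pos : 0 < ‖apex - 1‖ :=
  norm_pos_iff.2 fun h => by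
    have him := congrArg Complex.im h
    norm_num [apex] at him

/-- The rotation taking the direction of `apex` to the direction of `apex - 1`. -/
noncomputable def turn : ℂ := ⟨-3 / 5, 4 / 5⟩

theorem norm_turn : ‖turn‖ = 1 := by
  rw [Complex.norm_def, Complex.normSq_apply]
  norm_num [turn]

theorem turn_mul_apex : turn * apex = apex - 1 := by
  apply Complex.ext <;> norm_num [turn, apex]

theorem linearForm_turn_mul (z : ℂ) : linearForm 1 2 (turn * z) = linearForm 1 (-2) z := by
  simp only [linearForm_apply, turn, Complex.mul_re, Complex.mul_im]
  ring

theorem S_two_eq_S_one (r : ℝ) (z : ℂ) :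
    (cornerPolygon r).S 2 z = (cornerPolygon r).S 1 (1 + ((2 / 3) ^ 5 : ℝ) • (turn * z)) := by
  rw [S_one, S_two]
  apply Complex.ext <;>
    simp only [turn, Complex.add_re, Complex.add_im, Complex.one_re, Complex.one_im,
      Complex.smul_re, Complex.smul_im, smul_eq_mul, Complex.mul_re, Complex.mul_im] <;> ring

theorem exists_abs_sub_le_dist (hr : r ∈ Ioo (1 / 3) (4 / 9)) :
    ∃ C, ∀ i ∈ Icc 1 4, ∀ j ∈ Icc 2 5, ∀ z ∈ flatTriangle, ∀ w ∈ flatTriangle,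
      ∀ ρ σ : ℝ, 0 ≤ ρ → 0 ≤ σ → |ρ - (2 / 3) ^ 5 * σ| ≤
        C * dist ((cornerPolygon r).S 1 (1 + ρ • ((cornerPolygon r).S i z - 1)))
          ((cornerPolygon r).S 2 (σ • (cornerPolygon r).S j w)) := by
  obtain ⟨κ, hκ, hleft, hright⟩ := exists_forall_mul_norm_S_sub_apex_le hr
  refine ⟨(1 + ‖linearForm 1 2‖ / κ) * (9 / 4) / ‖apex - 1‖,
    fun i hi j hj z hz w hw ρ σ hρ hσ => ?_⟩
  have hcone := abs_sub_mul_norm_le (linearForm 1 2) (e := apex - 1)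
    (a := (cornerPolygon r).S i z - apex) (b := turn * ((cornerPolygon r).S j w - apex))
    (σ := (2 / 3) ^ 5 * σ) hκ (by norm_num [linearForm_apply, apex])
    ((hleft i hi z hz).trans_eq (by simp only [linearForm_apply]; ring))
    (by rw [norm_mul, norm_turn, one_mul, linearForm_turn_mul]; exact hright j hj w hw)
    hρ (by positivity)
  have hdist : dist ((cornerPolygon r).S 1 (1 + ρ • ((cornerPolygon r).S i z - 1)))
      ((cornerPolygon r).S 2 (σ • (cornerPolygon r).S j w)) =
      4 / 9 * dist (ρ • (apex - 1 + ((cornerPolygon r).S i z - apex)))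
        (((2 / 3) ^ 5 * σ) • (apex - 1 + turn * ((cornerPolygon r).S j w - apex))) := by
    rw [S_two_eq_S_one, dist_S_one, dist_add_left, ← turn_mul_apex, ← mul_add,
      turn_mul_apex, add_sub_cancel, mul_smul_comm, mul_smul, sub_add_sub_cancel']
  rw [hdist, div_mul_eq_mul_div, le_div_iff₀ norm_apex_sub_one_pos]
  linarith

/-! ### The curves -/

open unitInterval

/-- `γ` is the self-similar curve of `cornerPolygon r`, from `0` to `1` in the basic triangle. -/
structure IsCornerCurve (r : ℝ) (γ : I → ℂ) : Prop
    extends IsSelfSimilarCurve 5 (cornerPolygon r).S γ where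
  map_zero : γ 0 = 0
  map_one : γ 1 = 1
  mem_flatTriangle : ∀ s, γ s ∈ flatTriangle

section CornerCurve

variable {γ : I → ℂ}

theorem S_ne_zero (hr : r ∈ Ioo (1 / 3) (4 / 9)) {j : ℕ} (hj : j ∈ Icc 2 5) {z : ℂ}
    (hz : z ∈ flatTriangle) : (cornerPolygon r).S j z ≠ 0 := by
  obtain ⟨hr1, hr2⟩ := hr
  obtain ⟨hj2, hj5⟩ := hj
  obtain ⟨hz1, hz2, hz3⟩ := hz
  have hfour : 0 ≤ (1 / 2 - r) * z.re := mul_nonneg (by linarith) (by linarith)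
  have hfive : 0 ≤ r * z.re := mul_nonneg (by linarith) (by linarith)
  intro h
  have hre := congrArg Complex.re h
  interval_cases j <;>
    simp only [S_two, S_three, S_four, S_five, Complex.zero_re] at hre <;> linarith

theorem S_ne_one (hr : r ∈ Ioo (1 / 3) (4 / 9)) {j : ℕ} (hj : j ∈ Icc 1 4) {z : ℂ}
    (hz : z ∈ flatTriangle) : (cornerPolygon r).S j z ≠ 1 := by
  obtain ⟨hr1, hr2⟩ := hr
  obtain ⟨hj1, hj4⟩ := hj
  obtain ⟨hz1, hz2, hz3⟩ := hz
  have hfour : 0 ≤ (1 / 2 - r) * (1 - z.re) := mul_nonneg (by linarith) (by linarith)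
  intro h
  have hre := congrArg Complex.re h
  interval_cases j <;>
    simp only [S_one, S_two, S_three, S_four, Complex.one_re] at hre <;> linarith

theorem exists_isCornerCurve (hr : r ∈ Ioo (1 / 3) (4 / 9)) : ∃ γ, IsCornerCurve r γ := by
  have hlip : ∀ j ∈ Icc 1 5, LipschitzWith (4 / 9) ((cornerPolygon r).S j) := fun j hj =>
    LipschitzWith.of_dist_le_mul fun z w => by
      rw [Polygon.dist_S]
      exact mul_le_mul_of_nonneg_right (by simpa using norm_ratio_le hr hj) dist_nonneg
  have hjoined : JoinedIn flatTriangle 0 1 :=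
    (convex_flatTriangle.isPathConnected ⟨0, zero_mem_flatTriangle⟩).joinedIn
      _ zero_mem_flatTriangle _ one_mem_flatTriangle
  obtain ⟨γ, hγ, hzero, hone, hmem⟩ := exists_isSelfSimilarCurve
    (A := (cornerPolygon r).A) (by norm_num) (NNReal.coe_lt_coe.1 (by norm_num)) hlip
    (fun j _ => S_zero r j) (fun j _ => S_apply_one r j) isClosed_flatTriangle
    (fun j hj => mapsTo_S hr hj) hjoined
  exact ⟨γ, hγ, hzero, hone, hmem⟩

namespace IsCornerCurve

theorem exists_eq_pow_smul (hγ : IsCornerCurve r γ) {t : I} (ht : t ≠ 0) :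
    ∃ n : ℕ, ∃ j ∈ Icc 2 5, ∃ z ∈ flatTriangle,
      γ t = (4 / 9 : ℝ) ^ n • (cornerPolygon r).S j z := by
  refine ne_zero_induction (n := 5) (p := fun t => ∃ n : ℕ, ∃ j ∈ Icc 2 5, ∃ z ∈ flatTriangle,
    γ t = (4 / 9 : ℝ) ^ n • (cornerPolygon r).S j z) (by norm_num) (fun j hj2 hj5 t => ?_)
    (fun t _ ⟨n, j, hj, z, hz, heq⟩ => ?_) ht
  · exact ⟨0, j, ⟨hj2, hj5⟩, γ t, hγ.mem_flatTriangle t, by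
      rw [pow_zero, one_smul, hγ.semiconj j ⟨by omega, hj5⟩]⟩
  · exact ⟨n + 1, j, hj, z, hz, by
      rw [hγ.semiconj 1 (by norm_num), S_one_eq_smul, heq, smul_smul, pow_succ']⟩

theorem exists_eq_one_add_pow_smul (hγ : IsCornerCurve r γ) {s : I} (hs : s ≠ 1) :
    ∃ m : ℕ, ∃ i ∈ Icc 1 4, ∃ z ∈ flatTriangle,
      γ s = 1 + r ^ m • ((cornerPolygon r).S i z - 1) := by
  refine ne_one_induction (n := 5) (p := fun s => ∃ m : ℕ, ∃ i ∈ Icc 1 4, ∃ z ∈ flatTriangle,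
    γ s = 1 + r ^ m • ((cornerPolygon r).S i z - 1)) (by norm_num) (fun i hi1 hi5 s => ?_)
    (fun s _ ⟨m, i, hi, z, hz, heq⟩ => ?_) hs
  · exact ⟨0, i, ⟨hi1, by omega⟩, γ s, hγ.mem_flatTriangle s, by
      rw [pow_zero, one_smul, add_sub_cancel, hγ.semiconj i ⟨hi1, by omega⟩]⟩
  · exact ⟨m + 1, i, hi, z, hz, by
      rw [hγ.semiconj 5 (by norm_num), S_five_eq_add_smul, heq, add_sub_cancel_left, smul_smul,
        pow_succ']⟩

theorem apply_ne_zero (hγ : IsCornerCurve r γ) (hr : r ∈ Ioo (1 / 3) (4 / 9)) {t : I}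
    (ht : t ≠ 0) : γ t ≠ 0 := by
  obtain ⟨n, j, hj, z, hz, heq⟩ := hγ.exists_eq_pow_smul ht
  exact heq ▸ smul_ne_zero (pow_ne_zero _ (by norm_num)) (S_ne_zero hr hj hz)

theorem apply_ne_one (hγ : IsCornerCurve r γ) (hr : r ∈ Ioo (1 / 3) (4 / 9)) {s : I}
    (hs : s ≠ 1) : γ s ≠ 1 := by
  obtain ⟨m, i, hi, z, hz, heq⟩ := hγ.exists_eq_one_add_pow_smul hs
  rw [heq, Ne, add_eq_left]
  exact smul_ne_zero (pow_ne_zero _ (by linarith [hr.1])) (sub_ne_zero.2 (S_ne_one hr hi hz))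

theorem exists_eq_pow_smul_apex (hγ : IsCornerCurve r γ) (n : ℕ) :
    ∃ t, γ t = (4 / 9 : ℝ) ^ n • apex := by
  induction n with
  | zero => exact ⟨subpart 5 4 0, by
      rw [hγ.semiconj 4 (by norm_num), hγ.map_zero, S_zero, pow_zero, one_smul, A_three]⟩
  | succ n ih =>
    obtain ⟨t, ht⟩ := ih
    exact ⟨subpart 5 1 t, by
      rw [hγ.semiconj 1 (by norm_num), S_one_eq_smul, ht, smul_smul, pow_succ']⟩

theorem exists_eq_one_add_pow_smul_apex (hγ : IsCornerCurve r γ) (m : ℕ) :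
    ∃ s, γ s = 1 + r ^ m • (apex - 1) := by
  induction m with
  | zero => exact ⟨subpart 5 4 0, by
      rw [hγ.semiconj 4 (by norm_num), hγ.map_zero, S_zero, pow_zero, one_smul, A_three,
        add_sub_cancel]⟩
  | succ m ih =>
    obtain ⟨s, hs⟩ := ih
    exact ⟨subpart 5 5 s, by
      rw [hγ.semiconj 5 (by norm_num), S_five_eq_add_smul, hs, add_sub_cancel_left, smul_smul,
        pow_succ']⟩

theorem isArcParam (hγ : IsCornerCurve r γ) (hinj : Function.Injective γ) :
    IsArcParam (range γ) γ :=
  ⟨hγ.continuous, hinj, rfl⟩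

theorem exists_scales_le (hγ : IsCornerCurve r γ) (hr : r ∈ Ioo (1 / 3) (4 / 9)) :
    ∃ C, ∀ s t, s ≠ 1 → t ≠ 0 → ∃ m n : ℕ,
      |r ^ m - (2 / 3) ^ (2 * n + 5)| ≤
        C * dist ((cornerPolygon r).S 1 (γ s)) ((cornerPolygon r).S 2 (γ t)) ∧
      dist ((cornerPolygon r).S 1 (γ s)) ((cornerPolygon r).A 1) +
        dist ((cornerPolygon r).A 1) ((cornerPolygon r).S 2 (γ t)) ≤
          2 * max (r ^ m) ((2 / 3) ^ (2 * n + 5)) := by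
  have hr0 : 0 ≤ r := by linarith [hr.1]
  obtain ⟨C, hC⟩ := exists_abs_sub_le_dist hr
  refine ⟨C, fun s t hs ht => ?_⟩
  obtain ⟨m, i, hi, z, hz, hγs⟩ := hγ.exists_eq_one_add_pow_smul hs
  obtain ⟨n, j, hj, w, hw, hγt⟩ := hγ.exists_eq_pow_smul ht
  have hscale : ((2 : ℝ) / 3) ^ (2 * n + 5) = (2 / 3) ^ 5 * (4 / 9) ^ n := by
    rw [pow_add, pow_mul, mul_comm]
    norm_num
  have hleft : dist ((cornerPolygon r).S 1 (γ s)) ((cornerPolygon r).A 1) ≤ r ^ m := by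
    have hd := dist_le_two_of_mem_flatTriangle
      (mapsTo_S hr (j := i) ⟨hi.1, by linarith [hi.2]⟩ hz) one_mem_flatTriangle
    rw [← S_apply_one, dist_S_one, hγs, dist_self_add_left, norm_smul, ← dist_eq_norm,
      Real.norm_of_nonneg (by positivity)]
    nlinarith [pow_nonneg hr0 m]
  have hright : dist ((cornerPolygon r).A 1) ((cornerPolygon r).S 2 (γ t)) ≤
      (2 / 3) ^ (2 * n + 5) := by
    have hd := dist_le_two_of_mem_flatTriangle
      (mapsTo_S hr (j := j) ⟨by linarith [hj.1], hj.2⟩ hw) zero_mem_flatTriangle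
    rw [dist_zero_right] at hd
    rw [← S_apply_one, S_two_eq_S_one, dist_S_one, dist_self_add_right, norm_smul, norm_mul,
      norm_turn, one_mul, hγt, norm_smul, Real.norm_of_nonneg (by positivity),
      Real.norm_of_nonneg (by positivity), hscale]
    have : (0 : ℝ) ≤ (2 / 3) ^ 5 * (4 / 9) ^ n := by positivity
    nlinarith
  refine ⟨m, n, ?_, ?_⟩
  · rw [hγs, hγt, hscale]
    exact hC i hi j hj z hz w hw _ _ (by positivity) (by positivity)
  · linarith [le_max_left (r ^ m) ((2 / 3 : ℝ) ^ (2 * n + 5)),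
      le_max_right (r ^ m) ((2 / 3 : ℝ) ^ (2 * n + 5))]

theorem S_ne_S_succ (hγ : IsCornerCurve r γ) (hr : IsAdmissibleRatio r) {i : ℕ}
    (hi : i ∈ Icc 1 4) {s t : I} (hst : s ≠ 1 ∨ t ≠ 0) :
    (cornerPolygon r).S i (γ s) ≠ (cornerPolygon r).S (i + 1) (γ t) := by
  have hinj : ∀ {j}, j ∈ Icc 1 5 → Function.Injective ((cornerPolygon r).S j) :=
    Polygon.S_injective (injOn_A hr.mem_Ioo)
  have hi' : i ∈ Icc 1 5 := ⟨hi.1, by linarith [hi.2]⟩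
  have hi1 : i + 1 ∈ Icc 1 5 := ⟨by omega, Nat.succ_le_succ hi.2⟩
  have hcorner : (cornerPolygon r).S (i + 1) 0 = (cornerPolygon r).S i 1 := by
    rw [S_zero, S_apply_one, Nat.add_sub_cancel]
  intro h
  by_cases hs : s = 1
  · rw [hs, hγ.map_one, ← hcorner] at h
    exact hγ.apply_ne_zero hr.mem_Ioo (hst.resolve_left (not_not.2 hs)) (hinj hi1 h).symm
  by_cases ht : t = 0
  · rw [ht, hγ.map_zero, hcorner] at h
    exact hγ.apply_ne_one hr.mem_Ioo hs (hinj hi' h)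
  obtain rfl | hi2 := hi.1.eq_or_lt
  · obtain ⟨C, hC⟩ := hγ.exists_scales_le hr.mem_Ioo
    obtain ⟨m, n, hmn, -⟩ := hC s t hs ht
    rw [h, dist_self, mul_zero] at hmn
    exact hr.pow_ne m n (sub_eq_zero.1 (abs_nonpos_iff.1 hmn))
  · obtain ⟨C, hC⟩ := exists_dist_add_dist_le hr.mem_Ioo ⟨hi2, hi.2⟩
    have hle := hC _ (hγ.mem_flatTriangle s) _ (hγ.mem_flatTriangle t)
    rw [h, dist_self, mul_zero, ← h, ← S_apply_one] at hle
    have hzero : dist ((cornerPolygon r).S i (γ s)) ((cornerPolygon r).S i 1) = 0 := by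
      linarith [dist_nonneg (x := (cornerPolygon r).S i (γ s)) (y := (cornerPolygon r).S i 1),
        dist_nonneg (x := (cornerPolygon r).S i 1) (y := (cornerPolygon r).S i (γ s))]
    exact hγ.apply_ne_one hr.mem_Ioo hs (hinj hi' (dist_eq_zero.1 hzero))

theorem S_ne_S_of_subpart_lt (hγ : IsCornerCurve r γ) (hr : IsAdmissibleRatio r) (i j : ℕ)
    (hi : 1 ≤ i) (hij : i < j) (hj : j ≤ 5) (s t : I) (hst : subpart 5 i s < subpart 5 j t) :
    (cornerPolygon r).S i (γ s) ≠ (cornerPolygon r).S j (γ t) := by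
  obtain rfl | hij := (Nat.succ_le_of_lt hij).eq_or_lt
  · exact hγ.S_ne_S_succ hr ⟨hi, Nat.le_of_succ_le_succ hj⟩
      ((subpart_lt_subpart_succ_iff hi hj).1 hst)
  · exact S_ne_S hr.mem_Ioo hi hij hj (hγ.mem_flatTriangle s) (hγ.mem_flatTriangle t)

theorem injective (hγ : IsCornerCurve r γ) (hr : IsAdmissibleRatio r) : Function.Injective γ :=
  hγ.toIsSelfSimilarCurve.injective (by norm_num)
    (fun _ => Polygon.S_injective (injOn_A hr.mem_Ioo)) (hγ.S_ne_S_of_subpart_lt hr)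

theorem isSelfSimilarArc (hγ : IsCornerCurve r γ) (hr : IsAdmissibleRatio r) :
    IsSelfSimilarArc 5 (cornerPolygon r).S (range γ) :=
  hγ.toIsSelfSimilarCurve.isSelfSimilarArc (by norm_num)
    (fun _ => Polygon.S_injective (injOn_A hr.mem_Ioo)) (hγ.S_ne_S_of_subpart_lt hr)

theorem dist_add_dist_le_four (hγ : IsCornerCurve r γ) (hr : r ∈ Ioo (1 / 3) (4 / 9)) {i : ℕ}
    (hi : i ∈ Icc 1 4) (s t : I) :
    dist ((cornerPolygon r).S i (γ s)) ((cornerPolygon r).A i) +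
      dist ((cornerPolygon r).A i) ((cornerPolygon r).S (i + 1) (γ t)) ≤ 4 := by
  have hmem : ∀ {j}, j ∈ Icc 1 5 → ∀ {z}, z ∈ flatTriangle →
    (cornerPolygon r).S j z ∈ flatTriangle := fun hj _ hz => mapsTo_S hr hj hz
  have hi' : i ∈ Icc 1 5 := ⟨hi.1, by linarith [hi.2]⟩
  have hi1 : i + 1 ∈ Icc 1 5 := ⟨by omega, Nat.succ_le_succ hi.2⟩
  have hA := S_apply_one r i ▸ hmem hi' one_mem_flatTriangle
  linarith [dist_le_two_of_mem_flatTriangle (hmem hi' (hγ.mem_flatTriangle s)) hA,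
    dist_le_two_of_mem_flatTriangle hA (hmem hi1 (hγ.mem_flatTriangle t))]

theorem exists_rpow_first_corner_le (hγ : IsCornerCurve r γ) (hr : r ∈ Ioo (1 / 3) (4 / 9))
    {τ : ℝ} (hτ : 1 ≤ τ) (h : HasCornerBound τ r) :
    ∃ C, ∀ s t, (dist ((cornerPolygon r).S 1 (γ s)) ((cornerPolygon r).A 1) +
      dist ((cornerPolygon r).A 1) ((cornerPolygon r).S 2 (γ t))) ^ τ ≤
        C * dist ((cornerPolygon r).S 1 (γ s)) ((cornerPolygon r).S 2 (γ t)) := by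
  obtain ⟨C₁, hC₁⟩ := hγ.exists_scales_le hr
  obtain ⟨C₂, hC₂⟩ := h
  have : 0 ≤ r := by linarith [hr.1]
  refine ⟨max (4 ^ (τ - 1) * 1) (2 ^ τ * |C₂| * C₁), fun s t => ?_⟩
  by_cases hst : s = 1 ∨ t = 0
  · refine (rpow_le_mul_of_le (by positivity)
      (hγ.dist_add_dist_le_four hr (by norm_num) s t) hτ (K := 1) ?_).trans
        (mul_le_mul_of_nonneg_right (le_max_left _ _) dist_nonneg)
    rcases hst with rfl | rfl
    · rw [hγ.map_one, S_apply_one, dist_self, zero_add, one_mul]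
    · rw [hγ.map_zero, S_zero, dist_self, add_zero, one_mul]
  · obtain ⟨hs, ht⟩ := not_or.1 hst
    obtain ⟨m, n, habs, hsum⟩ := hC₁ s t hs ht
    refine le_trans ?_ (mul_le_mul_of_nonneg_right (le_max_right _ _) dist_nonneg)
    calc _ ≤ (2 * max (r ^ m) ((2 / 3) ^ (2 * n + 5))) ^ τ := by gcongr
      _ = 2 ^ τ * max (r ^ m) ((2 / 3) ^ (2 * n + 5)) ^ τ :=
          Real.mul_rpow (by norm_num) (by positivity)
      _ ≤ 2 ^ τ * (|C₂| * |r ^ m - (2 / 3) ^ (2 * n + 5)|) := by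
          gcongr
          exact (hC₂ m n).trans (mul_le_mul_of_nonneg_right (le_abs_self C₂) (abs_nonneg _))
      _ ≤ 2 ^ τ * (|C₂| * (C₁ * _)) := by gcongr
      _ = _ := by ring

theorem exists_rpow_corner_le (hγ : IsCornerCurve r γ) (hr : r ∈ Ioo (1 / 3) (4 / 9)) {τ : ℝ}
    (hτ : 1 ≤ τ) (h : HasCornerBound τ r) {i : ℕ} (hi : i ∈ Icc 1 4) :
    ∃ C, ∀ s t, (dist ((cornerPolygon r).S i (γ s)) ((cornerPolygon r).A i) +
      dist ((cornerPolygon r).A i) ((cornerPolygon r).S (i + 1) (γ t))) ^ τ ≤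
        C * dist ((cornerPolygon r).S i (γ s)) ((cornerPolygon r).S (i + 1) (γ t)) := by
  obtain rfl | hi2 := hi.1.eq_or_lt
  · exact hγ.exists_rpow_first_corner_le hr hτ h
  · obtain ⟨C, hC⟩ := exists_dist_add_dist_le hr ⟨hi2, hi.2⟩
    exact ⟨_, fun s t => rpow_le_mul_of_le (by positivity)
      (hγ.dist_add_dist_le_four hr hi s t) hτ
      (hC _ (hγ.mem_flatTriangle s) _ (hγ.mem_flatTriangle t))⟩

theorem isQuasiArc_of_hasCornerBound (hγ : IsCornerCurve r γ) (hr : IsAdmissibleRatio r) {τ : ℝ}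
    (hτ : 1 ≤ τ) (h : HasCornerBound τ r) : IsQuasiArc τ (range γ) := by
  have hev : ∀ᶠ C in atTop, ∀ i ∈ Icc 1 4, ∀ s t,
      (dist ((cornerPolygon r).S i (γ s)) ((cornerPolygon r).A i) +
        dist ((cornerPolygon r).A i) ((cornerPolygon r).S (i + 1) (γ t))) ^ τ ≤
      C * dist ((cornerPolygon r).S i (γ s)) ((cornerPolygon r).S (i + 1) (γ t)) := by
    refine (eventually_all_finite (finite_Icc 1 4)).2 fun i hi => ?_
    obtain ⟨C, hC⟩ := hγ.exists_rpow_corner_le hr.mem_Ioo hτ h hi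
    filter_upwards [eventually_ge_atTop C] with C' hCC' s t
    exact (hC s t).trans (mul_le_mul_of_nonneg_right hCC' dist_nonneg)
  obtain ⟨C, hC⟩ := hev.exists
  refine hγ.toIsSelfSimilarCurve.isQuasiArc (ρ := fun j => ‖(cornerPolygon r).ratio j‖₊)
    (by norm_num) (hγ.injective hr) (fun j _ => (cornerPolygon r).dist_S j)
    (fun j hj => ?_) hτ ⟨C, fun i hi hi5 s t => ?_⟩
  · exact (norm_ratio_le hr.mem_Ioo hj).trans (by norm_num)
  · rw [hγ.map_one, S_apply_one]
    exact hC i ⟨hi, Nat.le_of_succ_le_succ hi5⟩ s t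

theorem exists_mem_uIcc_apply_eq (hγ : IsCornerCurve r γ) (m n : ℕ) :
    ∃ s t, ∃ u ∈ uIcc s t,
      γ s = (cornerPolygon r).S 1 (1 + r ^ m • (apex - 1)) ∧
      γ t = (cornerPolygon r).S 1 (1 + ((2 / 3) ^ (2 * n + 5) : ℝ) • (apex - 1)) ∧
      γ u = (cornerPolygon r).S 1 1 := by
  obtain ⟨s, hs⟩ := hγ.exists_eq_one_add_pow_smul_apex m
  obtain ⟨t, ht⟩ := hγ.exists_eq_pow_smul_apex n
  refine ⟨subpart 5 1 s, subpart 5 2 t, subpart 5 1 1, mem_uIcc_of_le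
    ((strictMono_subpart (by norm_num)).monotone le_one')
    (subpart_le_subpart le_rfl (by norm_num) (by norm_num) 1 t), ?_, ?_, ?_⟩
  · rw [hγ.semiconj 1 (by norm_num), hs]
  · rw [hγ.semiconj 2 (by norm_num), ht, S_two_eq_S_one, mul_smul_comm, turn_mul_apex,
      smul_smul, pow_add, pow_mul, mul_comm]
    norm_num
  · rw [hγ.semiconj 1 (by norm_num), hγ.map_one]

theorem hasCornerBound_of_isQuasiArc (hγ : IsCornerCurve r γ) (hr : IsAdmissibleRatio r) {τ : ℝ}
    (hτ : 1 ≤ τ) (h : IsQuasiArc τ (range γ)) : HasCornerBound τ r := by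
  have hr0 : 0 ≤ r := by linarith [hr.one_third_lt]
  obtain ⟨C, -, hdiam⟩ := ((hγ.isArcParam (hγ.injective hr)).isQuasiArc_iff (by linarith)).1 h
  let K : ℝ := 4 / 9 * ‖apex - 1‖
  have hK : 0 < K := mul_pos (by norm_num) norm_apex_sub_one_pos
  have hdist : ∀ a b : ℝ, dist ((cornerPolygon r).S 1 (1 + a • (apex - 1)))
      ((cornerPolygon r).S 1 (1 + b • (apex - 1))) = K * |a - b| := fun a b => by
    rw [dist_S_one, dist_add_left, dist_eq_norm, ← sub_smul, norm_smul, Real.norm_eq_abs,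
      mul_left_comm, mul_comm]
  have hdist_one : ∀ a : ℝ, 0 ≤ a →
      dist ((cornerPolygon r).S 1 (1 + a • (apex - 1))) ((cornerPolygon r).S 1 1) = K * a :=
    fun a ha => by simpa [abs_of_nonneg ha] using hdist a 0
  refine ⟨C * K / K ^ τ, fun m n => ?_⟩
  obtain ⟨s, t, u, hu, hs, ht, hcorner⟩ := hγ.exists_mem_uIcc_apply_eq m n
  have hbdd : Bornology.IsBounded (γ '' uIcc s t) :=
    (isCompact_uIcc.image hγ.continuous).isBounded
  have hmax : K * max (r ^ m) ((2 / 3) ^ (2 * n + 5)) ≤ Metric.diam (γ '' uIcc s t) := by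
    rw [mul_max_of_nonneg _ _ hK.le, ← hdist_one _ (by positivity),
      ← hdist_one _ (by positivity), ← hs, ← ht, ← hcorner]
    exact max_le
      (Metric.dist_le_diam_of_mem hbdd (mem_image_of_mem γ left_mem_uIcc) (mem_image_of_mem γ hu))
      (Metric.dist_le_diam_of_mem hbdd (mem_image_of_mem γ right_mem_uIcc) (mem_image_of_mem γ hu))
  rw [div_mul_eq_mul_div, le_div_iff₀ (by positivity), mul_comm,
    ← Real.mul_rpow hK.le (by positivity), mul_assoc C, ← hdist, ← hs, ← ht]
  exact (Real.rpow_le_rpow (by positivity) hmax (by linarith)).trans (hdiam s t)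

end IsCornerCurve

end CornerCurve

theorem exists_generatesRegularArc (hr : IsAdmissibleRatio r) :
    ∃ Λ, (cornerPolygon r).GeneratesRegularArc Λ ∧
      ∀ τ, 1 ≤ τ → (IsQuasiArc τ Λ ↔ HasCornerBound τ r) := by
  obtain ⟨γ, hγ⟩ := exists_isCornerCurve hr.mem_Ioo
  exact ⟨range γ, ⟨isBasicFigure hr.mem_Ioo, characteristicAngle_pos hr.mem_Ioo,
    hγ.isSelfSimilarArc hr⟩, fun τ hτ =>
      ⟨hγ.hasCornerBound_of_isQuasiArc hr hτ, hγ.isQuasiArc_of_hasCornerBound hr hτ⟩⟩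

end cornerPolygon

end Polygons

end RegularArc

theorem theorem7p15 :
    (∃ (P : RegularArc.Polygon) (Λ : Set ℂ), P.GeneratesRegularArc Λ ∧ P.thetaMin = 0 ∧
      ∀ t : ℝ, 1 ≤ t → ¬ RegularArc.IsQuasiArc t Λ) ∧
    (∀ t₀ : ℝ, 1 < t₀ →
      ∃ (P : RegularArc.Polygon) (Λ : Set ℂ), P.GeneratesRegularArc Λ ∧ P.thetaMin = 0 ∧
        RegularArc.IsQuasiArc t₀ Λ ∧
        ∀ t : ℝ, 1 ≤ t → t < t₀ → ¬ RegularArc.IsQuasiArc t Λ) ∧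
    (∀ t₀ : ℝ, 1 ≤ t₀ →
      ∃ (P : RegularArc.Polygon) (Λ : Set ℂ), P.GeneratesRegularArc Λ ∧ P.thetaMin = 0 ∧
        (∀ t : ℝ, t₀ < t → RegularArc.IsQuasiArc t Λ) ∧
        ¬ RegularArc.IsQuasiArc t₀ Λ) := by
  refine ⟨?_, fun t₀ ht₀ => ?_, fun t₀ ht₀ => ?_⟩
  · obtain ⟨r, hr, hnot⟩ := RegularArc.exists_ratio_forall_not_hasCornerBound
    obtain ⟨Λ, hΛ, hiff⟩ := RegularArc.cornerPolygon.exists_generatesRegularArc hr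
    exact ⟨_, Λ, hΛ, RegularArc.cornerPolygon.thetaMin_eq_zero r,
      fun t ht => mt (hiff t ht).1 (hnot t ht)⟩
  · obtain ⟨r, hr, hbound, hnot⟩ := RegularArc.exists_ratio_hasCornerBound_forall_lt ht₀
    obtain ⟨Λ, hΛ, hiff⟩ := RegularArc.cornerPolygon.exists_generatesRegularArc hr
    exact ⟨_, Λ, hΛ, RegularArc.cornerPolygon.thetaMin_eq_zero r, (hiff t₀ ht₀.le).2 hbound,
      fun t ht htt₀ => mt (hiff t ht).1 (hnot t ht htt₀)⟩
  · obtain ⟨r, hr, hbound, hnot⟩ := RegularArc.exists_ratio_not_hasCornerBound_forall_gt ht₀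
    obtain ⟨Λ, hΛ, hiff⟩ := RegularArc.cornerPolygon.exists_generatesRegularArc hr
    exact ⟨_, Λ, hΛ, RegularArc.cornerPolygon.thetaMin_eq_zero r,
      fun t ht => (hiff t (ht₀.trans ht.le)).2 (hbound t ht), mt (hiff t₀ ht₀).1 hnot⟩
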